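/- Let $Z$ be a random variable taking nonnegative integer values such that $\mathbb{E} Z<\infty$ and $Z\ge 2$ almost surely. Let $(T,\rho)$ be the rooted Galton--Watson tree with offspring variable $Z$ (every vertex has an independent number of children distributed as $Z$; $\rho$ has no parent). Given $T$, let $(X_t)_{t\ge 0}$ be simple random walk on $T$ started at $\rho$ (each step goes to a uniformly chosen neighbor of the current vertex), and let $(Y_t)_{t\ge 0}$ be nonbacktracking random walk on $T$ started at $\rho$ (the first step goes to a uniformly chosen neighbor of $\rho$, and each later step goes to a uniformly chosen neighbor of the current vertex other than the vertex visited just before). For a probability measure $\mu$ on the vertices of $T$ let $H(\mu)=-\sum_{x\in T}\mu(x)\log\mu(x)$, with $0\log 0=0$. Then there are deterministic real numbers $\mathbf{h}_X$ and $\mathbf{h}_Y$ such that, almost surely with respect to $T$, $$\lim_{t\to\infty}\frac1t H\big(\mathbb{P}_\rho(X_t\in\cdot\mid T)\big)=\mathbf{h}_X ,\qquad \lim_{t\to\infty}\frac1t H\big(\mathbb{P}_\rho(Y_t\in\cdot\mid T)\big)=\mathbf{h}_Y ,$$ and they satisfy $$\mathbf{h}_X<\mathbf{h}_Y=\mathbb{E}\log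 Z .$$ -/

import Mathlib

open MeasureTheory ProbabilityTheory Filter Topology

/-! ### Galton–Watson trees in Ulam–Harris coding

A possible individual is a word `u : List ℕ`; the root is the empty word and the word `i :: u`
is the `i`-th potential child of `u` (words are read from the right, the parent is the tail).
The family `D : List ℕ → ℕ` records the number of children `D u` of each individual `u`. -/

/-- `IsGWVertex D u`: the word `u` is a vertex of the tree with offspring numbers `D`, that is,
`u` is the root, or `u = i :: w` with `w` a vertex and `i < D w`. -/
def IsGWVertex (D : List ℕ → ℕ) : List ℕ → Prop
  | [] => True
  | i :: w => IsGWVertex D w ∧ i < D w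

/-- The tree `T` with offspring numbers `D`, as a graph: two vertices of the tree are adjacent
when one is a child of the other. Words that are not vertices of the tree are isolated; no walk
started at the root can reach them. -/
def gwTree (D : List ℕ → ℕ) : SimpleGraph (List ℕ) where
  Adj u v := IsGWVertex D u ∧ IsGWVertex D v ∧ ((∃ i, v = i :: u) ∨ (∃ i, u = i :: v))
  symm := ⟨fun _ _ h => ⟨h.2.1, h.1, h.2.2.symm⟩⟩
  loopless := ⟨fun u h => by
    rcases h.2.2 with ⟨i, hi⟩ | ⟨i, hi⟩ <;> exact absurd hi.symm (List.cons_ne_self i u)⟩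

/-- The law of the offspring numbers of a Galton–Watson process with offspring law `ν`:
all individuals reproduce independently according to `ν`. The random tree is `gwTree D` for `D`
sampled from this measure. -/
noncomputable def gwMeasure (ν : Measure ℕ) : Measure (List ℕ → ℕ) :=
  Measure.infinitePi fun _ : List ℕ => ν

/-! ### Simple and nonbacktracking random walk on a graph, through their laws -/

open Classical in
/-- The uniform distribution on `s` if `s` is finite and nonempty; otherwise the point mass at the
default state `x`. -/
noncomputable def uniformOr {V : Type*} (s : Set V) (x : V) : PMF V :=
  if h : s.Finite ∧ s.Nonempty then
    PMF.uniformOfFinset h.1.toFinset (h.1.toFinset_nonempty.mpr h.2)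
  else PMF.pure x

/-- Transition law of simple random walk: from `x`, move to a uniformly chosen neighbor. -/
noncomputable def srwStep {V : Type*} (G : SimpleGraph V) (x : V) : PMF V :=
  uniformOr (G.neighborSet x) x

/-- The law `P_ρ(X_t ∈ ·)` of simple random walk on `G` started at `ρ` after `t` steps. -/
noncomputable def srwLaw {V : Type*} (G : SimpleGraph V) (ρ : V) : ℕ → PMF V
  | 0 => PMF.pure ρ
  | t + 1 => (srwLaw G ρ t).bind (srwStep G)

/-- Transition law of the nonbacktracking walk, on pairs (previous position, current position):
from `(x, y)`, move to `(y, z)` with `z` uniformly chosen among the neighbors of `y` other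
than `x`. -/
noncomputable def nbrwStep {V : Type*} (G : SimpleGraph V) (p : V × V) : PMF (V × V) :=
  (uniformOr (G.neighborSet p.2 \ {p.1}) p.2).map fun z => (p.2, z)

/-- The law of (previous position, current position) of the nonbacktracking walk started at `ρ`.
The initial state is `(ρ, ρ)`: as `ρ` is not its own neighbor, nothing is excluded in the first
step, which therefore goes to a uniformly chosen neighbor of `ρ`. -/
noncomputable def nbrwPairLaw {V : Type*} (G : SimpleGraph V) (ρ : V) : ℕ → PMF (V × V)
  | 0 => PMF.pure (ρ, ρ)
  | t + 1 => (nbrwPairLaw G ρ t).bind (nbrwStep G)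

/-- The law `P_ρ(Y_t ∈ ·)` of the nonbacktracking walk on `G` started at `ρ` after `t` steps. -/
noncomputable def nbrwLaw {V : Type*} (G : SimpleGraph V) (ρ : V) (t : ℕ) : PMF V :=
  (nbrwPairLaw G ρ t).map Prod.snd

/-! ### Entropy -/

/-- The Shannon entropy `H(μ) = - ∑ x, μ(x) log μ(x)`, with `0 log 0 = 0`. (The laws of the walks
above on a locally finite graph have finite support, so that the sum is then finite.) -/
noncomputable def shannonEntropy {V : Type*} (μ : PMF V) : ℝ :=
  -∑' x, (μ x).toReal * Real.log (μ x).toReal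

/-- `h` is the asymptotic entropy of simple random walk, started at the root, on the
Galton–Watson tree with offspring law `ν`: almost surely,
`(1/t) H(P_ρ(X_t ∈ · | T)) → h` as `t → ∞`. -/
def IsSRWEntropy (ν : Measure ℕ) (h : ℝ) : Prop :=
  ∀ᵐ D ∂(gwMeasure ν),
    Tendsto (fun t : ℕ => (1 / (t : ℝ)) * shannonEntropy (srwLaw (gwTree D) [] t)) atTop (𝓝 h)

/-- `h` is the asymptotic entropy of nonbacktracking random walk, started at the root, on the
Galton–Watson tree with offspring law `ν`: almost surely,
`(1/t) H(P_ρ(Y_t ∈ · | T)) → h` as `t → ∞`. -/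
def IsNBRWEntropy (ν : Measure ℕ) (h : ℝ) : Prop :=
  ∀ᵐ D ∂(gwMeasure ν),
    Tendsto (fun t : ℕ => (1 / (t : ℝ)) * shannonEntropy (nbrwLaw (gwTree D) [] t)) atTop (𝓝 h)

/-!
Both walks move along random rays of the tree, and both entropies are read off from ergodic averages
along these rays. The rays are described by flow rules: at each vertex a child is chosen, with
probabilities that depend on the tree below the vertex. For the nonbacktracking walk the choice is
uniform; for simple random walk it is made according to harmonic measure, that is, proportionally to
the effective conductances from the children to infinity (`uniformFlow`, `harmonicFlow`).

*Ergodic theory.* The trees below the vertices of such a ray form a Markov chain. It is stationary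
for the Galton–Watson measure in the uniform case (`isStationaryFlow_uniformFlow`). In the harmonic
case it is stationary for the measure whose density at `T` is the mean of the conductance
`S S' / (S + S' + S S')` between the two ends of the tree made of `T` and an independent `T'` with
their roots joined by an edge, where `S` and `S'` are the conductances of `T` and `T'`
(`isStationaryFlow_harmonicFlow`). The chain is ergodic, since the trees below two different
children of the root are independent. By Hilbert space duality every centred square integrable
function is then close in mean to a bounded coboundary `χ - Qχ`, and Garsia's maximal inequality
turns this into control of the ergodic averages along almost every tree
(`IsStationaryFlow.ae_exists_coboundary`).

*The nonbacktracking walk.* Its law on level `t` is the uniform flow, so its entropy is the sum over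
`k < t` of the flow averages of `log D` on level `k`, `D` being the number of children. The rate is
the mean of `log D` for the Galton–Watson measure.

*Simple random walk.* The Green function has an explicit form in terms of the harmonic flow, and
up to a bounded error its logarithm is minus the sum of `log (1 + S)` over the strict ancestors of a
vertex, `S` being the conductance of the tree below the ancestor. The law at
time `t` is dominated by the Green function, the mass of which in the ball of radius `t` is at most
linear in `t`. Hence the entropy is, up to `O(log t)`, the mean of the sum of `log (1 + S)` over the
ancestors of the current position (`AtLeastBinary.abs_shannonEntropy_srwLaw_sub_le`). Such sums grow
at a speed that is found by martingales: a martingale along the harmonic flow becomes a martingale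
of the walk once the expected returns are taken off
(`AtLeastBinary.neighborSum_edgeSum_sub_edgeReturn`). For `(D + 1) / S` in place of `log (1 + S)`
the mean of the sum is the time up to a bounded error, and this function has integral `1` for the stationary measure
(`lintegral_timePerLevel`), so that the rate for `log (1 + S)` is its integral for that measure
(`walkEntropyRate`).

*The inequality.* By stationarity the integral of `log (1 + S)` is that of the entropy of a step of
the harmonic flow, which is at most `log D`. The density of the stationary measure is less than `1`,
as `S S' / (S + S' + S S')` is, so the integral of `log D` for it is strictly less than that for the
Galton–Watson measure (`walkEntropyRate_lt`).
-/


/-! ### Subtrees, levels and the measure-preserving relabellings of a Galton–Watson tree -/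

/-- The offspring numbers of the subtree of descendants of `x`. Words are read from the right, so
the descendant of `x` reached along `u` is `u ++ x`. -/
def subtree (T : List ℕ → ℕ) (x : List ℕ) : List ℕ → ℕ := fun u => T (u ++ x)

@[simp] lemma subtree_nil (T : List ℕ → ℕ) : subtree T [] = T := by
  funext u; simp [subtree]

lemma subtree_apply_nil (T : List ℕ → ℕ) (x : List ℕ) : subtree T x [] = T x := rfl

lemma subtree_subtree (T : List ℕ → ℕ) (x y : List ℕ) :
    subtree (subtree T x) y = subtree T (y ++ x) := by
  funext u; simp [subtree]

lemma subtree_singleton (T : List ℕ → ℕ) (x : List ℕ) (i : ℕ) :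
    subtree (subtree T x) [i] = subtree T (i :: x) := subtree_subtree T x [i]

lemma measurable_subtree (x : List ℕ) : Measurable fun T : List ℕ → ℕ => subtree T x :=
  measurable_pi_lambda _ fun _ => measurable_pi_apply _

/-- Every individual has at least two children. -/
def AtLeastBinary (T : List ℕ → ℕ) : Prop := ∀ u, 2 ≤ T u

protected lemma AtLeastBinary.subtree {T : List ℕ → ℕ} (hT : AtLeastBinary T) (x : List ℕ) :
    AtLeastBinary (subtree T x) := fun _ => hT _

/-- The vertices of the tree at distance `n` from the root. -/
def level (T : List ℕ → ℕ) : ℕ → Finset (List ℕ)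
  | 0 => {[]}
  | n + 1 => (level T n).biUnion fun x => (Finset.range (T x)).image (· :: x)

lemma mem_level {T : List ℕ → ℕ} {n : ℕ} {x : List ℕ} :
    x ∈ level T n ↔ IsGWVertex T x ∧ x.length = n := by
  induction n generalizing x with
  | zero =>
    constructor
    · intro h
      simp only [level, Finset.mem_singleton] at h
      subst h; simp [IsGWVertex]
    · rintro ⟨-, h⟩
      simp only [level, Finset.mem_singleton]
      exact List.length_eq_zero_iff.mp h
  | succ n ih =>
    simp only [level, Finset.mem_biUnion, Finset.mem_image, Finset.mem_range]
    constructor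
    · rintro ⟨y, hy, i, hi, rfl⟩
      obtain ⟨h1, h2⟩ := ih.mp hy
      exact ⟨⟨h1, hi⟩, by simp [h2]⟩
    · rintro ⟨h1, h2⟩
      cases x with
      | nil => simp at h2
      | cons i y =>
        exact ⟨y, ih.mpr ⟨h1.1, by simpa using h2⟩, i, h1.2, rfl⟩

lemma sum_level_succ {M : Type*} [AddCommMonoid M] (T : List ℕ → ℕ) (n : ℕ) (F : List ℕ → M) :
    ∑ y ∈ level T (n + 1), F y = ∑ x ∈ level T n, ∑ i ∈ Finset.range (T x), F (i :: x) := by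
  rw [level, Finset.sum_biUnion]
  · refine Finset.sum_congr rfl fun x _ => ?_
    rw [Finset.sum_image]
    intro i _ j _ h
    exact (List.cons.inj h).1
  · intro x _ y _ hxy
    refine Finset.disjoint_left.mpr fun z hz hz' => hxy ?_
    simp only [Finset.mem_image] at hz hz'
    obtain ⟨i, _, rfl⟩ := hz
    obtain ⟨j, _, h⟩ := hz'
    exact (List.cons.inj h).2.symm

section GaltonWatson

variable (ν : Measure ℕ) [IsProbabilityMeasure ν]

instance : IsProbabilityMeasure (gwMeasure ν) := by
  unfold gwMeasure; infer_instance

/-- Reading the offspring numbers along an injective coding of the individuals preserves the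
Galton–Watson measure. -/
lemma measurePreserving_comp_injective {f : List ℕ → List ℕ} (hf : Function.Injective f) :
    MeasurePreserving (fun T : List ℕ → ℕ => fun u => T (f u)) (gwMeasure ν) (gwMeasure ν) := by
  refine ⟨by fun_prop, ?_⟩
  exact Measure.map_infinitePi_infinitePi_of_inj (P := fun _ : List ℕ => ν) hf

lemma measurePreserving_subtree (x : List ℕ) :
    MeasurePreserving (fun T : List ℕ → ℕ => subtree T x) (gwMeasure ν) (gwMeasure ν) :=
  measurePreserving_comp_injective ν (f := fun u => u ++ x) (List.append_left_injective x)

lemma measurePreserving_apply (u : List ℕ) :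
    MeasurePreserving (fun T : List ℕ → ℕ => T u) (gwMeasure ν) ν :=
  measurePreserving_eval_infinitePi (fun _ : List ℕ => ν) u

lemma ae_atLeastBinary (hν : ∀ᵐ n ∂ν, 2 ≤ n) : ∀ᵐ T ∂(gwMeasure ν), AtLeastBinary T := by
  unfold AtLeastBinary
  rw [ae_all_iff]
  exact fun u => (measurePreserving_apply ν u).quasiMeasurePreserving.ae hν

/-- Exchange the labels `0` and `j` of the children of the root, in the coding of individuals. -/
def swapLabel (j : ℕ) : List ℕ → List ℕ
  | [] => []
  | [a] => [Equiv.swap 0 j a]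
  | a :: b :: l => a :: swapLabel j (b :: l)

lemma swapLabel_append (j a : ℕ) (w : List ℕ) :
    swapLabel j (w ++ [a]) = w ++ [Equiv.swap 0 j a] := by
  induction w with
  | nil => rfl
  | cons b w ih =>
    cases w with
    | nil => rfl
    | cons c w => simpa [swapLabel] using ih

lemma swapLabel_swapLabel (j : ℕ) (u : List ℕ) : swapLabel j (swapLabel j u) = u := by
  rcases List.eq_nil_or_concat u with rfl | ⟨w, a, rfl⟩
  · rfl
  · simp [swapLabel_append]

/-- The tree in which the subtrees at the children `0` and `j` of the root are exchanged. -/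
def swapTree (j : ℕ) (T : List ℕ → ℕ) : List ℕ → ℕ := fun u => T (swapLabel j u)

lemma swapTree_nil (j : ℕ) (T : List ℕ → ℕ) : swapTree j T [] = T [] := rfl

lemma subtree_swapTree (j a : ℕ) (T : List ℕ → ℕ) :
    subtree (swapTree j T) [a] = subtree T [Equiv.swap 0 j a] := by
  funext u; simp [subtree, swapTree, swapLabel_append]

lemma measurePreserving_swapTree (j : ℕ) :
    MeasurePreserving (swapTree j) (gwMeasure ν) (gwMeasure ν) :=
  measurePreserving_comp_injective ν
    (Function.LeftInverse.injective (swapLabel_swapLabel j))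

/-- The coding of individuals behind `graft`: descendants of child `0` go to the left summand,
all others go to the right summand, with the label at the root lowered by one. -/
def splitFirst : List ℕ → List ℕ ⊕ List ℕ
  | [] => .inr []
  | [0] => .inl []
  | [a + 1] => .inr [a]
  | a :: b :: l => (splitFirst (b :: l)).map (a :: ·) (a :: ·)

lemma splitFirst_append_zero (w : List ℕ) : splitFirst (w ++ [0]) = .inl w := by
  induction w with
  | nil => rfl
  | cons b w ih =>
    cases w with
    | nil => simp [splitFirst]
    | cons c w => simp only [List.cons_append] at ih ⊢; rw [splitFirst, ih]; rfl

lemma splitFirst_append_succ (w : List ℕ) (a : ℕ) :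
    splitFirst (w ++ [a + 1]) = .inr (w ++ [a]) := by
  induction w with
  | nil => rfl
  | cons b w ih =>
    cases w with
    | nil => simp [splitFirst]
    | cons c w => simp only [List.cons_append] at ih ⊢; rw [splitFirst, ih]; rfl

lemma splitFirst_injective : Function.Injective splitFirst := by
  intro u v h
  rcases List.eq_nil_or_concat u with rfl | ⟨w, a, rfl⟩ <;>
    rcases List.eq_nil_or_concat v with rfl | ⟨w', a', rfl⟩
  · rfl
  · cases a' <;> simp [splitFirst, splitFirst_append_zero, splitFirst_append_succ] at h
  · cases a <;> simp [splitFirst, splitFirst_append_zero, splitFirst_append_succ] at h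
  · cases a <;> cases a' <;>
      simp_all [splitFirst_append_zero, splitFirst_append_succ]

/-- The tree obtained from `p.2` by adding `p.1` as a new first subtree at the root. The number of
children recorded at the root is still that of `p.2`, so that the children of the root are now
`0, …, D` with `D` the recorded number. -/
def graft (p : (List ℕ → ℕ) × (List ℕ → ℕ)) : List ℕ → ℕ :=
  fun u => Sum.elim p.1 p.2 (splitFirst u)

lemma graft_nil (p : (List ℕ → ℕ) × (List ℕ → ℕ)) : graft p [] = p.2 [] := rfl

lemma subtree_graft_zero (p : (List ℕ → ℕ) × (List ℕ → ℕ)) : subtree (graft p) [0] = p.1 := by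
  funext u; simp [subtree, graft, splitFirst_append_zero]

lemma subtree_graft_succ (p : (List ℕ → ℕ) × (List ℕ → ℕ)) (i : ℕ) :
    subtree (graft p) [i + 1] = subtree p.2 [i] := by
  funext u; simp [subtree, graft, splitFirst_append_succ]

lemma measurePreserving_sumElim :
    MeasurePreserving (fun p : (List ℕ → ℕ) × (List ℕ → ℕ) => Sum.elim p.1 p.2)
      ((gwMeasure ν).prod (gwMeasure ν))
      (Measure.infinitePi fun _ : List ℕ ⊕ List ℕ => ν) := by
  have hmeas : Measurable
      (fun p : (List ℕ → ℕ) × (List ℕ → ℕ) => (Sum.elim p.1 p.2 : List ℕ ⊕ List ℕ → ℕ)) := by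
    refine measurable_pi_lambda _ fun a => ?_
    cases a <;> simp only [Sum.elim_inl, Sum.elim_inr] <;> fun_prop
  refine ⟨hmeas, Measure.eq_infinitePi _ fun s t ht => ?_⟩
  rw [Measure.map_apply hmeas (MeasurableSet.pi s.countable_toSet fun i _ => ht i)]
  have : (fun p : (List ℕ → ℕ) × (List ℕ → ℕ) => (Sum.elim p.1 p.2 : List ℕ ⊕ List ℕ → ℕ)) ⁻¹'
      (Set.pi s t) = (Set.pi s.toLeft fun u => t (.inl u)) ×ˢ
        (Set.pi s.toRight fun u => t (.inr u)) := by
    ext p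
    simp only [Set.mem_preimage, Set.mem_pi, Set.mem_prod, Finset.mem_coe, Finset.mem_toLeft,
      Finset.mem_toRight]
    constructor
    · intro h
      exact ⟨fun u hu => h _ hu, fun u hu => h _ hu⟩
    · rintro ⟨h1, h2⟩ (u | u) hu
      · exact h1 u hu
      · exact h2 u hu
  rw [this, Measure.prod_prod]
  unfold gwMeasure
  rw [Measure.infinitePi_pi _ (fun i _ => ht _), Measure.infinitePi_pi _ (fun i _ => ht _)]
  conv_rhs => rw [← Finset.toLeft_disjSum_toRight (u := s), Finset.prod_disjSum]

/-- A Galton–Watson tree is obtained by grafting one Galton–Watson tree onto the root of an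
independent one (the children with labels at least `D` are not vertices, but have subtrees of their
own in the coding). -/
lemma measurePreserving_graft :
    MeasurePreserving graft ((gwMeasure ν).prod (gwMeasure ν)) (gwMeasure ν) := by
  have h : MeasurePreserving (fun g : List ℕ ⊕ List ℕ → ℕ => fun u => g (splitFirst u))
      (Measure.infinitePi fun _ : List ℕ ⊕ List ℕ => ν) (gwMeasure ν) := by
    refine ⟨by fun_prop, ?_⟩
    exact Measure.map_infinitePi_infinitePi_of_inj
      (P := fun _ : List ℕ ⊕ List ℕ => ν) splitFirst_injective
  exact h.comp (measurePreserving_sumElim ν)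

end GaltonWatson

/-! ### Effective conductance -/

/-- The conductance from the parent of the root through the root down to level `n`, all edges having
unit conductance. -/
noncomputable def conductanceTo : ℕ → (List ℕ → ℕ) → ℝ
  | 0, _ => 1
  | n + 1, T => (∑ i ∈ Finset.range (T []), conductanceTo n (subtree T [i])) /
      (1 + ∑ i ∈ Finset.range (T []), conductanceTo n (subtree T [i]))

/-- The effective conductance between infinity and an additional parent of the root. For simple
random walk on the tree with this additional vertex, it is the probability that the walk started
at the root never visits that vertex. -/
noncomputable def conductance (T : List ℕ → ℕ) : ℝ := ⨅ n, conductanceTo n T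

/-- The effective conductance between the root and infinity. -/
noncomputable def rootConductance (T : List ℕ → ℕ) : ℝ :=
  ∑ i ∈ Finset.range (T []), conductance (subtree T [i])

lemma conductanceTo_nonneg (n : ℕ) (T : List ℕ → ℕ) : 0 ≤ conductanceTo n T := by
  induction n generalizing T with
  | zero => simp [conductanceTo]
  | succ n ih =>
    have := Finset.sum_nonneg fun i (_ : i ∈ Finset.range (T [])) => ih (subtree T [i])
    rw [conductanceTo]; positivity

lemma div_one_add_le_div_one_add {a b : ℝ} (ha : 0 ≤ a) (hab : a ≤ b) :
    a / (1 + a) ≤ b / (1 + b) := by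
  rw [div_le_div_iff₀ (by linarith) (by linarith)]; nlinarith

lemma conductanceTo_succ_le (n : ℕ) (T : List ℕ → ℕ) :
    conductanceTo (n + 1) T ≤ conductanceTo n T := by
  induction n generalizing T with
  | zero =>
    have := Finset.sum_nonneg fun i (_ : i ∈ Finset.range (T [])) =>
      conductanceTo_nonneg 0 (subtree T [i])
    rw [conductanceTo, conductanceTo, div_le_one (by linarith)]; linarith
  | succ n ih =>
    rw [conductanceTo, conductanceTo.eq_2 T n]
    exact div_one_add_le_div_one_add
      (Finset.sum_nonneg fun i _ => conductanceTo_nonneg _ _)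
      (Finset.sum_le_sum fun i _ => ih _)

lemma bddBelow_conductanceTo (T : List ℕ → ℕ) : BddBelow (Set.range fun n => conductanceTo n T) :=
  ⟨0, by rintro _ ⟨n, rfl⟩; exact conductanceTo_nonneg n T⟩

lemma tendsto_conductanceTo (T : List ℕ → ℕ) :
    Tendsto (fun n => conductanceTo n T) atTop (𝓝 (conductance T)) :=
  tendsto_atTop_ciInf (antitone_nat_of_succ_le fun n => conductanceTo_succ_le n T)
    (bddBelow_conductanceTo T)

lemma conductance_nonneg (T : List ℕ → ℕ) : 0 ≤ conductance T :=
  le_ciInf fun n => conductanceTo_nonneg n T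

lemma conductance_le_one (T : List ℕ → ℕ) : conductance T ≤ 1 :=
  ciInf_le (bddBelow_conductanceTo T) 0

lemma rootConductance_nonneg (T : List ℕ → ℕ) : 0 ≤ rootConductance T :=
  Finset.sum_nonneg fun _ _ => conductance_nonneg _

lemma rootConductance_le (T : List ℕ → ℕ) : rootConductance T ≤ T [] := by
  calc rootConductance T ≤ ∑ _i ∈ Finset.range (T []), (1 : ℝ) :=
        Finset.sum_le_sum fun _ _ => conductance_le_one _
    _ = T [] := by simp

/-- The series law: the edge above the root followed by the tree. -/
lemma conductance_eq (T : List ℕ → ℕ) :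
    conductance T = rootConductance T / (1 + rootConductance T) := by
  have h1 : Tendsto (fun n => ∑ i ∈ Finset.range (T []), conductanceTo n (subtree T [i])) atTop
      (𝓝 (rootConductance T)) :=
    tendsto_finsetSum _ fun i _ => tendsto_conductanceTo _
  have h2 : Tendsto (fun n => conductanceTo (n + 1) T) atTop
      (𝓝 (rootConductance T / (1 + rootConductance T))) := by
    simp only [conductanceTo]
    exact h1.div (h1.const_add 1) (by linarith [rootConductance_nonneg T])
  exact tendsto_nhds_unique ((tendsto_add_atTop_iff_nat 1).mpr (tendsto_conductanceTo T)) h2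

lemma one_sub_conductance (T : List ℕ → ℕ) :
    1 - conductance T = 1 / (1 + rootConductance T) := by
  have := rootConductance_nonneg T
  rw [conductance_eq]; field_simp; ring

lemma AtLeastBinary.half_le_conductanceTo {T : List ℕ → ℕ} (hT : AtLeastBinary T) (n : ℕ) :
    1 / 2 ≤ conductanceTo n T := by
  induction n generalizing T with
  | zero => norm_num [conductanceTo]
  | succ n ih =>
    have h1 : (T [] : ℝ) * (1 / 2) ≤
        ∑ i ∈ Finset.range (T []), conductanceTo n (subtree T [i]) := by
      calc (T [] : ℝ) * (1 / 2) = ∑ _i ∈ Finset.range (T []), (1 / 2 : ℝ) := by simp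
        _ ≤ _ := Finset.sum_le_sum fun i _ => ih (hT.subtree [i])
    have h2 : (2 : ℝ) ≤ T [] := by exact_mod_cast hT []
    rw [conductanceTo, le_div_iff₀ (by linarith)]; linarith

lemma AtLeastBinary.half_le_conductance {T : List ℕ → ℕ} (hT : AtLeastBinary T) :
    1 / 2 ≤ conductance T :=
  le_ciInf hT.half_le_conductanceTo

lemma AtLeastBinary.half_le_rootConductance {T : List ℕ → ℕ} (hT : AtLeastBinary T) :
    (T [] : ℝ) / 2 ≤ rootConductance T := by
  calc (T [] : ℝ) / 2 = ∑ _i ∈ Finset.range (T []), (1 / 2 : ℝ) := by simp; ring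
    _ ≤ _ := Finset.sum_le_sum fun i _ => (hT.subtree [i]).half_le_conductance

lemma AtLeastBinary.two_le_cast {T : List ℕ → ℕ} (hT : AtLeastBinary T) (x : List ℕ) :
    (2 : ℝ) ≤ T x := by exact_mod_cast hT x

lemma AtLeastBinary.one_le_rootConductance {T : List ℕ → ℕ} (hT : AtLeastBinary T) :
    1 ≤ rootConductance T := by
  linarith [hT.half_le_rootConductance, hT.two_le_cast []]

/-- A sum over the children of the root is measurable in the tree. -/
lemma measurable_sum_children {M : Type*} [AddCommMonoid M] [MeasurableSpace M] [MeasurableAdd₂ M]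
    {F : ℕ → (List ℕ → ℕ) → M} (hF : ∀ i, Measurable (F i)) :
    Measurable fun T : List ℕ → ℕ => ∑ i ∈ Finset.range (T []), F i T := by
  have h : Measurable fun q : ℕ × (List ℕ → ℕ) => ∑ i ∈ Finset.range q.1, F i q.2 :=
    measurable_from_prod_countable_right fun n =>
      Finset.measurable_sum (Finset.range n) fun i _ => hF i
  have h' : Measurable fun T : List ℕ → ℕ => (T [], T) := by fun_prop
  exact h.comp h'

lemma measurable_conductanceTo (n : ℕ) : Measurable (conductanceTo n) := by
  induction n with
  | zero => exact measurable_const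
  | succ n ih =>
    have := measurable_sum_children (F := fun i T => conductanceTo n (subtree T [i]))
      fun i => ih.comp (measurable_subtree [i])
    exact this.div (this.const_add 1)

lemma measurable_conductance : Measurable conductance :=
  Measurable.iInf measurable_conductanceTo

lemma measurable_rootConductance : Measurable rootConductance :=
  measurable_sum_children fun i => measurable_conductance.comp (measurable_subtree [i])

/-! ### Flow rules and their maximal ergodic inequality -/

/-- A flow rule `p` sends the root of `T` to its child `i` with probability `p i T`. `flowAvg p g T`
is the mean of `g` at the subtree of the chosen child. -/
noncomputable def flowAvg (p : ℕ → (List ℕ → ℕ) → ℝ) (g : (List ℕ → ℕ) → ℝ) :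
    (List ℕ → ℕ) → ℝ :=
  fun T => ∑ i ∈ Finset.range (T []), p i T * g (subtree T [i])

/-- The probability that the ray chosen by the flow rule `p` passes through a given vertex. -/
noncomputable def flowWeight (p : ℕ → (List ℕ → ℕ) → ℝ) (T : List ℕ → ℕ) : List ℕ → ℝ
  | [] => 1
  | i :: x => flowWeight p T x * p i (subtree T x)

lemma iterate_flowAvg (p : ℕ → (List ℕ → ℕ) → ℝ) (n : ℕ) (g : (List ℕ → ℕ) → ℝ)
    (T : List ℕ → ℕ) :
    (flowAvg p)^[n] g T = ∑ x ∈ level T n, flowWeight p T x * g (subtree T x) := by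
  induction n generalizing g with
  | zero => simp [level, flowWeight]
  | succ n ih =>
    rw [Function.iterate_succ_apply, ih, sum_level_succ]
    refine Finset.sum_congr rfl fun x _ => ?_
    rw [flowAvg, Finset.mul_sum, subtree_apply_nil]
    refine Finset.sum_congr rfl fun i _ => ?_
    rw [flowWeight, subtree_singleton]; ring

/-- `m` is a stationary measure, equivalent to the Galton–Watson measure, for the Markov chain of
subtrees along a ray chosen by the flow rule `p`. -/
structure IsStationaryFlow (ν : Measure ℕ) (p : ℕ → (List ℕ → ℕ) → ℝ)
    (m : Measure (List ℕ → ℕ)) : Prop where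
  measurable : ∀ i, Measurable (p i)
  nonneg : ∀ i T, 0 ≤ p i T
  pos : ∀ T, AtLeastBinary T → ∀ i < T [], 0 < p i T
  sum_eq_one : ∀ T, AtLeastBinary T → ∑ i ∈ Finset.range (T []), p i T = 1
  absolutelyContinuous : m ≪ gwMeasure ν
  absolutelyContinuous' : gwMeasure ν ≪ m
  lintegral_eq : ∀ g : (List ℕ → ℕ) → ENNReal, Measurable g →
    ∫⁻ T, ∑ i ∈ Finset.range (T []), ENNReal.ofReal (p i T) * g (subtree T [i]) ∂m = ∫⁻ T, g T ∂m

lemma flowAvg_sub (p : ℕ → (List ℕ → ℕ) → ℝ) (g h : (List ℕ → ℕ) → ℝ) :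
    flowAvg p (g - h) = flowAvg p g - flowAvg p h := by
  funext T; simp [flowAvg, mul_sub, Finset.sum_sub_distrib]

namespace IsStationaryFlow

variable {ν : Measure ℕ} {p : ℕ → (List ℕ → ℕ) → ℝ}
  {m : Measure (List ℕ → ℕ)}

section Basic

variable (hp : IsStationaryFlow ν p m)
include hp

lemma flowAvg_mono {g h : (List ℕ → ℕ) → ℝ} (hgh : ∀ T, g T ≤ h T) (T : List ℕ → ℕ) :
    flowAvg p g T ≤ flowAvg p h T :=
  Finset.sum_le_sum fun i _ => mul_le_mul_of_nonneg_left (hgh _) (hp.nonneg i T)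

lemma flowAvg_nonneg {g : (List ℕ → ℕ) → ℝ} (hg : ∀ T, 0 ≤ g T) (T : List ℕ → ℕ) :
    0 ≤ flowAvg p g T :=
  Finset.sum_nonneg fun i _ => mul_nonneg (hp.nonneg i T) (hg _)

lemma abs_flowAvg_le (g : (List ℕ → ℕ) → ℝ) (T : List ℕ → ℕ) :
    |flowAvg p g T| ≤ flowAvg p (fun T => |g T|) T := by
  refine (Finset.abs_sum_le_sum_abs _ _).trans (le_of_eq ?_)
  refine Finset.sum_congr rfl fun i _ => ?_
  rw [abs_mul, abs_of_nonneg (hp.nonneg i T)]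

lemma flowAvg_const {T : List ℕ → ℕ} (hT : AtLeastBinary T) (c : ℝ) :
    flowAvg p (fun _ => c) T = c := by
  rw [flowAvg, ← Finset.sum_mul, hp.sum_eq_one T hT, one_mul]

lemma abs_flowAvg_le_of_bounded {g : (List ℕ → ℕ) → ℝ} {C : ℝ} (hg : ∀ T, |g T| ≤ C)
    {T : List ℕ → ℕ} (hT : AtLeastBinary T) : |flowAvg p g T| ≤ C := by
  refine (hp.abs_flowAvg_le g T).trans ?_
  rw [← hp.flowAvg_const hT C]
  exact hp.flowAvg_mono hg T

lemma flowWeight_nonneg (T : List ℕ → ℕ) (x : List ℕ) : 0 ≤ flowWeight p T x := by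
  induction x with
  | nil => simp [flowWeight]
  | cons i x ih => exact mul_nonneg ih (hp.nonneg _ _)

lemma sum_flowWeight {T : List ℕ → ℕ} (hT : AtLeastBinary T) (n : ℕ) :
    ∑ x ∈ level T n, flowWeight p T x = 1 := by
  induction n with
  | zero => simp [level, flowWeight]
  | succ n ih =>
    rw [sum_level_succ, ← ih]
    refine Finset.sum_congr rfl fun x _ => ?_
    simp only [flowWeight]
    rw [← Finset.mul_sum]
    have := hp.sum_eq_one _ (hT.subtree x)
    rw [subtree_apply_nil] at this
    rw [this, mul_one]

lemma measurable_flowAvg {g : (List ℕ → ℕ) → ℝ} (hg : Measurable g) :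
    Measurable (flowAvg p g) :=
  measurable_sum_children fun i => (hp.measurable i).mul (hg.comp (measurable_subtree [i]))

lemma lintegral_flowAvg {g : (List ℕ → ℕ) → ℝ} (hg : Measurable g) (h0 : ∀ T, 0 ≤ g T) :
    ∫⁻ T, ENNReal.ofReal (flowAvg p g T) ∂m = ∫⁻ T, ENNReal.ofReal (g T) ∂m := by
  rw [← hp.lintegral_eq _ hg.ennreal_ofReal]
  refine lintegral_congr fun T => ?_
  rw [flowAvg, ENNReal.ofReal_sum_of_nonneg fun i _ => mul_nonneg (hp.nonneg i T) (h0 _)]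
  exact Finset.sum_congr rfl fun i _ => ENNReal.ofReal_mul (hp.nonneg i T)

lemma integrable_flowAvg {g : (List ℕ → ℕ) → ℝ} (hg : Measurable g) (hi : Integrable g m) :
    Integrable (flowAvg p g) m := by
  have h : Integrable (flowAvg p fun T => |g T|) m := by
    refine ⟨(hp.measurable_flowAvg hg.abs).aestronglyMeasurable, ?_⟩
    rw [hasFiniteIntegral_iff_ofReal
      (Eventually.of_forall (hp.flowAvg_nonneg fun T => abs_nonneg (g T)))]
    rw [hp.lintegral_flowAvg hg.abs fun T => abs_nonneg _]
    exact (hasFiniteIntegral_iff_ofReal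
      (Eventually.of_forall fun T => abs_nonneg (g T))).mp hi.abs.2
  exact h.mono' (hp.measurable_flowAvg hg).aestronglyMeasurable
    (Eventually.of_forall fun T => hp.abs_flowAvg_le g T)

lemma integral_flowAvg {g : (List ℕ → ℕ) → ℝ} (hg : Measurable g) (hi : Integrable g m) :
    ∫ T, flowAvg p g T ∂m = ∫ T, g T ∂m := by
  have key : ∀ f : (List ℕ → ℕ) → ℝ, Measurable f → (∀ T, 0 ≤ f T) →
      ∫ T, flowAvg p f T ∂m = ∫ T, f T ∂m := by
    intro f hf h0
    rw [integral_eq_lintegral_of_nonneg_ae (Eventually.of_forall (hp.flowAvg_nonneg h0))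
      (hp.measurable_flowAvg hf).aestronglyMeasurable,
      integral_eq_lintegral_of_nonneg_ae (Eventually.of_forall h0) hf.aestronglyMeasurable,
      hp.lintegral_flowAvg hf h0]
  have h1 := key (fun T => |g T|) hg.abs fun T => abs_nonneg _
  have h2 := key ((fun T => |g T|) - g) (hg.abs.sub hg) fun T => by
    simp only [Pi.sub_apply]; linarith [le_abs_self (g T)]
  rw [flowAvg_sub] at h2
  simp only [Pi.sub_apply] at h2
  rw [integral_sub (hp.integrable_flowAvg hg.abs hi.abs) (hp.integrable_flowAvg hg hi),
    integral_sub hi.abs hi, h1] at h2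
  linarith

lemma ae_atLeastBinary [IsProbabilityMeasure ν] (hν : ∀ᵐ n ∂ν, 2 ≤ n) : ∀ᵐ T ∂m, AtLeastBinary T :=
  hp.absolutelyContinuous.ae_le (_root_.ae_atLeastBinary ν hν)

end Basic

/-- The optimal expected gain in a game along the ray chosen by `p` that pays `η - lam` at each
subtree and may be stopped at any time up to `n`. It bounds all the sums `∑ k < j, (Q ^ k η - lam)`
with `j ≤ n`, where `Q = flowAvg p`, as these are the gains from stopping at a fixed time. -/
noncomputable def maxPartialSum (p : ℕ → (List ℕ → ℕ) → ℝ) (η : (List ℕ → ℕ) → ℝ) (lam : ℝ) :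
    ℕ → (List ℕ → ℕ) → ℝ
  | 0 => fun _ => 0
  | n + 1 => fun T => max 0 (η T - lam + flowAvg p (maxPartialSum p η lam n) T)

section Maximal

variable (hp : IsStationaryFlow ν p m) {η : (List ℕ → ℕ) → ℝ}
  (hη : Measurable η) (hi : Integrable η m) (lam : ℝ)

lemma maxPartialSum_nonneg (p : ℕ → (List ℕ → ℕ) → ℝ) (η : (List ℕ → ℕ) → ℝ) (lam : ℝ) (n : ℕ)
    (T : List ℕ → ℕ) : 0 ≤ maxPartialSum p η lam n T := by
  cases n with
  | zero => exact le_rfl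
  | succ n => exact le_max_left _ _

include hp in
lemma maxPartialSum_le_succ (n : ℕ) (T : List ℕ → ℕ) :
    maxPartialSum p η lam n T ≤ maxPartialSum p η lam (n + 1) T := by
  induction n generalizing T with
  | zero => exact maxPartialSum_nonneg p η lam 1 T
  | succ n ih => exact max_le_max le_rfl (by gcongr; exact hp.flowAvg_mono ih T)

include hp in
lemma sum_iterate_sub_le_maxPartialSum {T : List ℕ → ℕ} (hT : AtLeastBinary T) (n : ℕ) :
    ∑ k ∈ Finset.range n, (flowAvg p)^[k] η T - n * lam ≤ maxPartialSum p η lam n T := by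
  induction n generalizing T with
  | zero => simp [maxPartialSum]
  | succ n ih =>
    refine le_trans ?_ (le_max_right _ _)
    have h1 : flowAvg p (fun T => ∑ k ∈ Finset.range n, (flowAvg p)^[k] η T - n * lam) T =
        ∑ k ∈ Finset.range n, (flowAvg p)^[k + 1] η T - n * lam := by
      have := hp.flowAvg_const hT (n * lam)
      simp only [flowAvg] at this ⊢
      simp only [mul_sub, Finset.sum_sub_distrib, this, Finset.mul_sum]
      rw [Finset.sum_comm]
      congr 1
      refine Finset.sum_congr rfl fun k _ => ?_
      rw [Function.iterate_succ_apply' _ k]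
      rfl
    have h2 : flowAvg p (fun T => ∑ k ∈ Finset.range n, (flowAvg p)^[k] η T - n * lam) T ≤
        flowAvg p (maxPartialSum p η lam n) T :=
      Finset.sum_le_sum fun i _ => mul_le_mul_of_nonneg_left (ih (hT.subtree [i])) (hp.nonneg i T)
    rw [Finset.sum_range_succ']
    push_cast
    simp only [Function.iterate_zero, id_eq]
    linarith

include hp hη in
lemma measurable_maxPartialSum (n : ℕ) : Measurable (maxPartialSum p η lam n) := by
  induction n with
  | zero => exact measurable_const
  | succ n ih => exact measurable_const.max ((hη.sub_const lam).add (hp.measurable_flowAvg ih))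

variable [IsFiniteMeasure m]

include hp hη hi in
lemma integrable_maxPartialSum (n : ℕ) : Integrable (maxPartialSum p η lam n) m := by
  induction n with
  | zero => exact integrable_zero _ _ _
  | succ n ih =>
    refine Integrable.sup (integrable_zero _ _ _) ?_
    exact (hi.sub (integrable_const lam)).add
      (hp.integrable_flowAvg (hp.measurable_maxPartialSum hη lam n) ih)

include hp hη hi in
/-- Garsia's argument for the maximal inequality, up to a fixed time. -/
lemma mul_measureReal_maxPartialSum_le (h0 : ∀ T, 0 ≤ η T) (n : ℕ) :
    lam * m.real {T | 0 < maxPartialSum p η lam n T} ≤ ∫ T, η T ∂m := by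
  cases n with
  | zero =>
    simp only [maxPartialSum, lt_self_iff_false, Set.ofPred_false, measureReal_empty, mul_zero]
    exact integral_nonneg h0
  | succ n =>
    have hM := hp.integrable_maxPartialSum hη hi lam
    set A := {T | 0 < maxPartialSum p η lam (n + 1) T} with hA
    have hAm : MeasurableSet A := measurableSet_lt measurable_const
      (hp.measurable_maxPartialSum hη lam (n + 1))
    have hQ := hp.integrable_flowAvg (hp.measurable_maxPartialSum hη lam n) (hM n)
    have h1 : ∫ T, (maxPartialSum p η lam (n + 1) T - flowAvg p (maxPartialSum p η lam n) T) ∂m ≤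
        ∫ T, A.indicator (fun T => η T - lam) T ∂m := by
      refine integral_mono ((hM (n + 1)).sub hQ)
        ((hi.sub (integrable_const lam)).indicator hAm) fun T => ?_
      by_cases hT : T ∈ A
      · rw [Set.indicator_of_mem hT]
        have : maxPartialSum p η lam (n + 1) T =
            η T - lam + flowAvg p (maxPartialSum p η lam n) T := by
          have h : 0 < max 0 (η T - lam + flowAvg p (maxPartialSum p η lam n) T) := hT
          exact max_eq_right_of_lt (by simpa using h)
        simp only [this]; linarith
      · rw [Set.indicator_of_notMem hT]
        have h : maxPartialSum p η lam (n + 1) T ≤ 0 := not_lt.mp hT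
        have h' := hp.flowAvg_nonneg (maxPartialSum_nonneg p η lam n) T
        simp only; linarith
    rw [integral_sub (hM (n + 1)) hQ,
      hp.integral_flowAvg (hp.measurable_maxPartialSum hη lam n) (hM n),
      integral_indicator hAm, integral_sub hi.integrableOn (integrable_const lam).integrableOn,
      setIntegral_const] at h1
    have h2 : ∫ T, maxPartialSum p η lam n T ∂m ≤ ∫ T, maxPartialSum p η lam (n + 1) T ∂m :=
      integral_mono (hM n) (hM (n + 1)) (hp.maxPartialSum_le_succ lam n)
    have h3 : ∫ T in A, η T ∂m ≤ ∫ T, η T ∂m :=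
      setIntegral_le_integral hi (Eventually.of_forall h0)
    simp only [smul_eq_mul] at h1
    linarith

include hp hη hi in
/-- The maximal ergodic inequality for the Markov chain of subtrees. -/
lemma measure_exists_lt_sum_iterate_le [IsProbabilityMeasure ν] (hν : ∀ᵐ n ∂ν, 2 ≤ n)
    (h0 : ∀ T, 0 ≤ η T) {lam : ℝ} (hlam : 0 < lam) :
    m {T | ∃ n : ℕ, n * lam < ∑ k ∈ Finset.range n, (flowAvg p)^[k] η T} ≤
      ENNReal.ofReal ((∫ T, η T ∂m) / lam) := by
  have h1 : {T | ∃ n : ℕ, n * lam < ∑ k ∈ Finset.range n, (flowAvg p)^[k] η T} ≤ᵐ[m]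
      ⋃ n, {T | 0 < maxPartialSum p η lam n T} := by
    filter_upwards [hp.ae_atLeastBinary hν] with T hT
    rintro ⟨n, hn⟩
    have := hp.sum_iterate_sub_le_maxPartialSum (η := η) lam hT n
    have h : T ∈ ⋃ n, {T | 0 < maxPartialSum p η lam n T} :=
      Set.mem_iUnion.mpr ⟨n, by simp only [Set.mem_ofPred_eq]; linarith⟩
    exact h
  refine (measure_mono_ae h1).trans ?_
  have hmono : Monotone fun n => {T | 0 < maxPartialSum p η lam n T} :=
    monotone_nat_of_le_succ fun n T hT => lt_of_lt_of_le hT (hp.maxPartialSum_le_succ lam n T)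
  rw [hmono.measure_iUnion]
  refine iSup_le fun n => ?_
  rw [← ofReal_measureReal]
  refine ENNReal.ofReal_le_ofReal ?_
  rw [le_div_iff₀ hlam, mul_comm]
  exact hp.mul_measureReal_maxPartialSum_le hη hi lam h0 n

end Maximal

end IsStationaryFlow

/-! ### Ergodicity and approximation by coboundaries -/

lemma flowAvg_add (p : ℕ → (List ℕ → ℕ) → ℝ) (g h : (List ℕ → ℕ) → ℝ) :
    flowAvg p (g + h) = flowAvg p g + flowAvg p h := by
  funext T; simp [flowAvg, mul_add, Finset.sum_add_distrib]

lemma flowAvg_smul (p : ℕ → (List ℕ → ℕ) → ℝ) (a : ℝ) (g : (List ℕ → ℕ) → ℝ) :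
    flowAvg p (a • g) = a • flowAvg p g := by
  funext T
  simp only [flowAvg, Pi.smul_apply, smul_eq_mul, Finset.mul_sum]
  exact Finset.sum_congr rfl fun i _ => by ring

namespace IsStationaryFlow

variable {ν : Measure ℕ} [IsProbabilityMeasure ν] {p : ℕ → (List ℕ → ℕ) → ℝ}
  {m : Measure (List ℕ → ℕ)} (hp : IsStationaryFlow ν p m)

include hp

/-- Ergodicity: the subtrees at two different children of the root are independent, so a function
that takes the same value at both is constant. -/
lemma ae_eq_const_of_invariant (hν : ∀ᵐ n ∂ν, 2 ≤ n) {φ : (List ℕ → ℕ) → ℝ}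
    (hφ : ∀ᵐ T ∂m, ∀ i < T [], φ (subtree T [i]) = φ T) : ∃ c, ∀ᵐ T ∂m, φ T = c := by
  have h1 : ∀ᵐ T ∂(gwMeasure ν), φ (subtree T [0]) = φ (subtree T [1]) := by
    filter_upwards [hp.absolutelyContinuous'.ae_le hφ, _root_.ae_atLeastBinary ν hν] with T h hT
    have h2 : 2 ≤ T [] := hT []
    rw [h 0 (by omega), h 1 (by omega)]
  have h2 := (measurePreserving_graft ν).quasiMeasurePreserving.ae h1
  have h3 := (Measure.measurePreserving_swap (μ := gwMeasure ν)
    (ν := gwMeasure ν)).quasiMeasurePreserving.ae h2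
  obtain ⟨T, hT⟩ := (Measure.ae_ae_of_ae_prod h3).exists
  refine ⟨φ (subtree T [0]), hp.absolutelyContinuous.ae_le ?_⟩
  filter_upwards [hT] with T' h
  rw [Prod.swap_prod_mk, subtree_graft_zero, subtree_graft_succ] at h
  exact h

variable [IsFiniteMeasure m]

lemma memLp_coboundary (hν : ∀ᵐ n ∂ν, 2 ≤ n) {χ : (List ℕ → ℕ) → ℝ} (hm : Measurable χ) {C : ℝ}
    (hb : ∀ T, |χ T| ≤ C) : MemLp (χ - flowAvg p χ) 2 m := by
  refine MemLp.of_bound (hm.sub (hp.measurable_flowAvg hm)).aestronglyMeasurable (C + C) ?_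
  filter_upwards [hp.ae_atLeastBinary hν] with T hT
  exact (abs_sub _ _).trans (add_le_add (hb T) (hp.abs_flowAvg_le_of_bounded hb hT))

/-- A bounded function `φ` with `∫ φ (φ - Q φ) ≤ 0`, where `Q = flowAvg p`, is constant: by
stationarity, twice this integral is the mean square of the increment of `φ` in one step. -/
lemma ae_eq_const_of_integral_nonpos (hν : ∀ᵐ n ∂ν, 2 ≤ n) {φ : (List ℕ → ℕ) → ℝ}
    (hm : Measurable φ) {C : ℝ} (hb : ∀ T, |φ T| ≤ C)
    (h : ∫ T, φ T * (φ T - flowAvg p φ T) ∂m ≤ 0) : ∃ c, ∀ᵐ T ∂m, φ T = c := by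
  refine hp.ae_eq_const_of_invariant hν ?_
  have hmQ := hp.measurable_flowAvg hm
  have hb2 : ∀ T, |φ T ^ 2| ≤ C ^ 2 := fun T => by
    rw [abs_pow]; exact pow_le_pow_left₀ (abs_nonneg _) (hb T) 2
  have i1 : Integrable (fun T => φ T ^ 2) m :=
    Integrable.of_bound (hm.pow_const 2).aestronglyMeasurable (C ^ 2) (Eventually.of_forall hb2)
  have i2 := hp.integrable_flowAvg (hm.pow_const 2) i1
  have i3 : Integrable (fun T => φ T * flowAvg p φ T) m := by
    refine Integrable.of_bound (hm.mul hmQ).aestronglyMeasurable (C * C) ?_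
    filter_upwards [hp.ae_atLeastBinary hν] with T hT
    rw [Real.norm_eq_abs, abs_mul]
    exact mul_le_mul (hb T) (hp.abs_flowAvg_le_of_bounded hb hT) (abs_nonneg _)
      ((abs_nonneg _).trans (hb T))
  set E : (List ℕ → ℕ) → ℝ :=
    fun T => flowAvg p (fun T => φ T ^ 2) T - 2 * (φ T * flowAvg p φ T) + φ T ^ 2 with hE
  have hEsum : ∀ T, AtLeastBinary T →
      E T = ∑ i ∈ Finset.range (T []), p i T * (φ (subtree T [i]) - φ T) ^ 2 := by
    intro T hT
    have : φ T ^ 2 = ∑ i ∈ Finset.range (T []), p i T * φ T ^ 2 := by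
      rw [← Finset.sum_mul, hp.sum_eq_one T hT, one_mul]
    simp only [hE]
    rw [this]
    simp only [flowAvg, Finset.mul_sum]
    rw [← Finset.sum_sub_distrib, ← Finset.sum_add_distrib]
    exact Finset.sum_congr rfl fun i _ => by ring
  have hE0 : 0 ≤ᵐ[m] E := by
    filter_upwards [hp.ae_atLeastBinary hν] with T hT
    rw [hEsum T hT]
    exact Finset.sum_nonneg fun i _ => mul_nonneg (hp.nonneg i T) (sq_nonneg _)
  have hEint : Integrable E m := (i2.sub (i3.const_mul 2)).add i1
  have hEle : ∫ T, E T ∂m ≤ 0 := by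
    have : ∫ T, E T ∂m = 2 * ∫ T, φ T * (φ T - flowAvg p φ T) ∂m := by
      have e1 : ∫ T, E T ∂m = ∫ T, flowAvg p (fun T => φ T ^ 2) T ∂m -
          2 * ∫ T, φ T * flowAvg p φ T ∂m + ∫ T, φ T ^ 2 ∂m := by
        rw [← integral_const_mul, ← integral_sub i2 (i3.const_mul 2)]
        exact integral_add (i2.sub (i3.const_mul 2)) i1
      have e2 : ∫ T, φ T * (φ T - flowAvg p φ T) ∂m =
          ∫ T, φ T ^ 2 ∂m - ∫ T, φ T * flowAvg p φ T ∂m := by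
        rw [← integral_sub i1 i3]
        exact integral_congr_ae (Eventually.of_forall fun T => by simp only; ring)
      rw [e1, e2, hp.integral_flowAvg (hm.pow_const 2) i1]; ring
    linarith
  have hEz : E =ᵐ[m] 0 := (integral_eq_zero_iff_of_nonneg_ae hE0 hEint).mp
    (le_antisymm hEle (integral_nonneg_of_ae hE0))
  filter_upwards [hEz, hp.ae_atLeastBinary hν] with T h0 hT i hi
  rw [hEsum T hT, Pi.zero_apply] at h0
  have := (Finset.sum_eq_zero_iff_of_nonneg fun i _ =>
    mul_nonneg (hp.nonneg i T) (sq_nonneg _)).mp h0 i (Finset.mem_range.mpr hi)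
  have := (mul_eq_zero.mp this).resolve_left (hp.pos T hT i hi).ne'
  have := pow_eq_zero_iff (two_ne_zero) |>.mp this
  linarith

/-- A square integrable function orthogonal to all bounded coboundaries is constant. As `Q` need not
act on the square integrable functions, the criterion for bounded functions is applied to the
truncations of `r`. -/
lemma ae_eq_const_of_orthogonal (hν : ∀ᵐ n ∂ν, 2 ≤ n) {r : (List ℕ → ℕ) → ℝ}
    (hr : Measurable r) (hri : Integrable r m)
    (h : ∀ χ : (List ℕ → ℕ) → ℝ, Measurable χ → ∀ C, (∀ T, |χ T| ≤ C) →
      ∫ T, r T * (χ T - flowAvg p χ T) ∂m = 0) : ∃ c, ∀ᵐ T ∂m, r T = c := by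
  set φ : ℕ → (List ℕ → ℕ) → ℝ := fun n T => max (-n) (min (r T) n) with hφ
  have hφm : ∀ n, Measurable (φ n) := fun n => measurable_const.max (hr.min measurable_const)
  have hφb : ∀ n T, |φ n T| ≤ n := fun n T =>
    abs_le.mpr ⟨le_max_left _ _, max_le (by linarith [Nat.cast_nonneg (α := ℝ) n])
      (min_le_right _ _)⟩
  have hφc : ∀ n, ∃ c, ∀ᵐ T ∂m, φ n T = c := by
    intro n
    refine hp.ae_eq_const_of_integral_nonpos hν (hφm n) (hφb n) ?_
    rw [← h (φ n) (hφm n) n (hφb n)]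
    have hmD : Measurable fun T => φ n T - flowAvg p (φ n) T :=
      (hφm n).sub (hp.measurable_flowAvg (hφm n))
    have hbD : ∀ᵐ T ∂m, |φ n T - flowAvg p (φ n) T| ≤ n + n := by
      filter_upwards [hp.ae_atLeastBinary hν] with T hT
      exact (abs_sub _ _).trans
        (add_le_add (hφb n T) (hp.abs_flowAvg_le_of_bounded (hφb n) hT))
    refine integral_mono_ae ?_ (hri.mul_bdd (c := n + n) hmD.aestronglyMeasurable hbD) ?_
    · exact (Integrable.of_bound (hφm n).aestronglyMeasurable (n : ℝ)
        (Eventually.of_forall (hφb n))).mul_bdd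
        (c := n + n) hmD.aestronglyMeasurable hbD
    · -- where `r` exceeds the truncation, the truncation is at its maximum
      filter_upwards [hp.ae_atLeastBinary hν] with T hT
      have hQ := abs_le.mp (hp.abs_flowAvg_le_of_bounded (hφb n) hT)
      have hn : (0 : ℝ) ≤ n := Nat.cast_nonneg n
      rcases le_total (r T) n with h1 | h1
      · rcases le_total (-(n : ℝ)) (r T) with h2 | h2
        · have : φ n T = r T := by simp only [hφ]; rw [min_eq_left h1, max_eq_right h2]
          rw [this]
        · have : φ n T = -n := by simp only [hφ]; rw [min_eq_left h1, max_eq_left h2]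
          rw [this]; nlinarith
      · have : φ n T = n := by
          simp only [hφ]; rw [min_eq_right h1, max_eq_right (by linarith)]
        rw [this]; nlinarith
  choose c hc using hφc
  have hall := ae_all_iff.mpr hc
  have hstab : ∀ T, ∀ n : ℕ, |r T| ≤ n → φ n T = r T := by
    intro T n hn
    have := abs_le.mp hn
    simp only [hφ]
    rw [min_eq_left this.2, max_eq_right this.1]
  have : (ae m).NeBot := by
    rw [ae_neBot]
    rintro rfl
    have := hp.absolutelyContinuous' (s := Set.univ) (by simp)
    simp at this
  obtain ⟨T₀, hT₀⟩ := hall.exists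
  refine ⟨r T₀, ?_⟩
  filter_upwards [hall] with T hT
  obtain ⟨n, hn⟩ := exists_nat_ge (max |r T| |r T₀|)
  rw [← hstab T n ((le_max_left _ _).trans hn), ← hstab T₀ n ((le_max_right _ _).trans hn),
    hT n, hT₀ n]

/-- A centred square integrable function is, up to a small error in mean, the coboundary of a
bounded function. -/
lemma exists_integral_abs_sub_coboundary_le (hν : ∀ᵐ n ∂ν, 2 ≤ n) {g : (List ℕ → ℕ) → ℝ}
    (hg2 : MemLp g 2 m) (hg0 : ∫ T, g T ∂m = 0) {ε : ℝ} (hε : 0 < ε) :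
    ∃ χ : (List ℕ → ℕ) → ℝ, Measurable χ ∧ (∃ C, ∀ T, |χ T| ≤ C) ∧
      ∫ T, |g T - (χ T - flowAvg p χ T)| ∂m ≤ ε := by
  let V : Submodule ℝ (Lp ℝ 2 m) :=
    { carrier := {f | ∃ χ : (List ℕ → ℕ) → ℝ, Measurable χ ∧ (∃ C, ∀ T, |χ T| ≤ C) ∧
        f =ᵐ[m] χ - flowAvg p χ}
      add_mem' := by
        rintro f₁ f₂ ⟨χ₁, hm₁, ⟨C₁, hC₁⟩, h₁⟩ ⟨χ₂, hm₂, ⟨C₂, hC₂⟩, h₂⟩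
        refine ⟨χ₁ + χ₂, hm₁.add hm₂, ⟨C₁ + C₂, fun T =>
          (abs_add_le _ _).trans (add_le_add (hC₁ T) (hC₂ T))⟩, ?_⟩
        filter_upwards [h₁, h₂, Lp.coeFn_add f₁ f₂] with T e₁ e₂ e
        rw [e, Pi.add_apply, e₁, e₂, flowAvg_add]
        simp only [Pi.add_apply, Pi.sub_apply]; ring
      zero_mem' := by
        refine ⟨0, measurable_const, ⟨0, by simp⟩, ?_⟩
        filter_upwards [Lp.coeFn_zero ℝ 2 m] with T e
        rw [e]; simp [flowAvg]
      smul_mem' := by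
        rintro a f ⟨χ, hm, ⟨C, hC⟩, h⟩
        refine ⟨a • χ, hm.const_smul a, ⟨|a| * C, fun T => ?_⟩, ?_⟩
        · rw [Pi.smul_apply, smul_eq_mul, abs_mul]
          exact mul_le_mul_of_nonneg_left (hC T) (abs_nonneg a)
        · filter_upwards [h, Lp.coeFn_smul a f] with T e₁ e
          rw [e, Pi.smul_apply, e₁, flowAvg_smul]
          simp only [Pi.smul_apply, Pi.sub_apply, smul_eq_mul]; ring }
  set G : Lp ℝ 2 m := hg2.toLp g with hG
  have hGg : G =ᵐ[m] g := hg2.coeFn_toLp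
  set K := V.topologicalClosure with hK
  have : CompleteSpace K := V.isClosed_topologicalClosure.completeSpace_coe
  set r : Lp ℝ 2 m := G - K.starProjection G with hr
  have hrK : r ∈ Kᗮ := K.sub_starProjection_mem_orthogonal G
  have hr2 : MemLp r 2 m := Lp.memLp r
  obtain ⟨c, hc⟩ := hp.ae_eq_const_of_orthogonal hν (Lp.stronglyMeasurable r).measurable
    (hr2.integrable one_le_two) (by
      intro χ hχ C hC
      have hmem := hp.memLp_coboundary hν hχ hC
      have hV : hmem.toLp _ ∈ K := V.le_topologicalClosure ⟨χ, hχ, ⟨C, hC⟩, hmem.coeFn_toLp⟩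
      have h0 := (Submodule.mem_orthogonal' K r).mp hrK _ hV
      rw [L2.inner_def] at h0
      rw [← h0]
      refine integral_congr_ae ?_
      filter_upwards [hmem.coeFn_toLp] with T e
      rw [e]; simp [mul_comm])
  have hr0 : r = 0 := by
    have h1 : inner ℝ r G = 0 := by
      rw [L2.inner_def]
      have : ∫ T, inner ℝ (r T) (G T) ∂m = ∫ T, c * g T ∂m := by
        refine integral_congr_ae ?_
        filter_upwards [hc, hGg] with T e1 e2
        rw [e1, e2]; simp [mul_comm]
      rw [this, integral_const_mul, hg0, mul_zero]
    have h2 : inner ℝ r (K.starProjection G) = 0 :=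
      (Submodule.mem_orthogonal' K r).mp hrK _ (K.starProjection_apply_mem G)
    have h3 : inner ℝ r r = 0 := by
      conv_lhs => rw [hr, inner_sub_right, ← hr, h1, h2, sub_zero]
    exact inner_self_eq_zero.mp h3
  have hGK : G ∈ closure (V : Set (Lp ℝ 2 m)) := by
    have : G = K.starProjection G := sub_eq_zero.mp hr0
    rw [← Submodule.topologicalClosure_coe, this]
    exact K.starProjection_apply_mem G
  set M := m.real Set.univ with hM
  have hM0 : 0 ≤ M := measureReal_nonneg
  set δ := ε / (M + 1) with hδ
  have hδ0 : 0 < δ := by positivity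
  obtain ⟨v, ⟨χ, hχ, ⟨C, hC⟩, hv⟩, hdist⟩ := Metric.mem_closure_iff.mp hGK δ hδ0
  refine ⟨χ, hχ, ⟨C, hC⟩, ?_⟩
  have hmem := hp.memLp_coboundary hν hχ hC
  set u : (List ℕ → ℕ) → ℝ := fun T => g T - (χ T - flowAvg p χ T) with hu
  have hu2 : MemLp u 2 m := hg2.sub hmem
  have huv : (G - v : Lp ℝ 2 m) =ᵐ[m] u := by
    filter_upwards [Lp.coeFn_sub G v, hGg, hv] with T e e1 e2
    rw [e, Pi.sub_apply, e1, e2]; rfl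
  have hsq : ∫ T, u T ^ 2 ∂m ≤ δ ^ 2 := by
    have : ∫ T, u T ^ 2 ∂m = inner ℝ (G - v) (G - v) := by
      rw [L2.inner_def]
      refine integral_congr_ae ?_
      filter_upwards [huv] with T e
      rw [e]; simp [sq]
    rw [this, real_inner_self_eq_norm_sq, ← dist_eq_norm]
    exact pow_le_pow_left₀ dist_nonneg hdist.le 2
  calc ∫ T, |u T| ∂m ≤ ∫ T, (δ + δ⁻¹ * u T ^ 2) ∂m := by
        refine integral_mono (hu2.integrable one_le_two).abs
          ((integrable_const δ).add (hu2.integrable_sq.const_mul _)) fun T => ?_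
        simp only
        have h1 : δ⁻¹ * u T ^ 2 = |u T| ^ 2 / δ := by rw [sq_abs]; ring
        rw [h1, ← sub_nonneg]
        have : δ + |u T| ^ 2 / δ - |u T| = ((δ - |u T|) ^ 2 + δ * |u T|) / δ := by
          field_simp; ring
        rw [this]; positivity
    _ = δ * M + δ⁻¹ * ∫ T, u T ^ 2 ∂m := by
        rw [integral_add (integrable_const δ) (hu2.integrable_sq.const_mul _), integral_const_mul,
          integral_const, smul_eq_mul, mul_comm]
    _ ≤ δ * M + δ⁻¹ * δ ^ 2 := by gcongr
    _ = ε := by rw [hδ]; field_simp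

/-- For a centred square integrable `g` and almost every tree, `g` differs from a bounded coboundary
by a function whose ergodic averages along that tree are all small. -/
lemma ae_exists_coboundary (hν : ∀ᵐ n ∂ν, 2 ≤ n) {g : (List ℕ → ℕ) → ℝ}
    (hg : Measurable g) (hg2 : MemLp g 2 m) (hg0 : ∫ T, g T ∂m = 0) :
    ∀ᵐ T ∂(gwMeasure ν), ∀ ε > 0, ∃ χ : (List ℕ → ℕ) → ℝ, (∃ C, ∀ T, |χ T| ≤ C) ∧
      ∀ n : ℕ, ∑ k ∈ Finset.range n,
        (flowAvg p)^[k] (fun T => |g T - (χ T - flowAvg p χ T)|) T ≤ n * ε := by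
  have hpos : ∀ j : ℕ, (0 : ℝ) < (1 / 4) ^ j := fun j => by positivity
  choose χ hχm hχb hχ using fun j => hp.exists_integral_abs_sub_coboundary_le hν hg2 hg0 (hpos j)
  set η : ℕ → (List ℕ → ℕ) → ℝ := fun j T => |g T - (χ j T - flowAvg p (χ j) T)| with hη
  have hηm : ∀ j, Measurable (η j) := fun j =>
    (hg.sub ((hχm j).sub (hp.measurable_flowAvg (hχm j)))).abs
  have hηi : ∀ j, Integrable (η j) m := fun j => by
    obtain ⟨C, hC⟩ := hχb j
    exact ((hg2.sub (hp.memLp_coboundary hν (hχm j) hC)).integrable one_le_two).abs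
  set B : ℕ → Set (List ℕ → ℕ) := fun j =>
    {T | ∃ n : ℕ, n * (1 / 2) ^ j < ∑ k ∈ Finset.range n, (flowAvg p)^[k] (η j) T} with hB
  have hBm : ∀ j, m (B j) ≤ ENNReal.ofReal ((1 / 2) ^ j) := fun j => by
    refine (hp.measure_exists_lt_sum_iterate_le (hηm j) (hηi j) hν (fun T => abs_nonneg _)
      (lam := (1 / 2) ^ j) (by positivity)).trans (ENNReal.ofReal_le_ofReal ?_)
    rw [div_le_iff₀ (by positivity), ← mul_pow]
    norm_num
    simpa using hχ j
  have hsum : ∑' j, m (B j) ≠ ⊤ := by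
    refine ne_top_of_le_ne_top ?_ (ENNReal.tsum_le_tsum hBm)
    rw [← ENNReal.ofReal_tsum_of_nonneg (fun j => by positivity) summable_geometric_two]
    exact ENNReal.ofReal_ne_top
  refine hp.absolutelyContinuous'.ae_le ?_
  filter_upwards [ae_eventually_notMem hsum] with T hT ε hε
  have h2 : ∀ᶠ j in atTop, ((1 : ℝ) / 2) ^ j < ε :=
    (tendsto_pow_atTop_nhds_zero_of_lt_one (by norm_num) (by norm_num)).eventually_lt_const hε
  obtain ⟨j, hj1, hj2⟩ := (hT.and h2).exists
  refine ⟨χ j, hχb j, fun n => ?_⟩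
  have : ¬ ∃ n : ℕ, n * ((1 : ℝ) / 2) ^ j < ∑ k ∈ Finset.range n, (flowAvg p)^[k] (η j) T := hj1
  push Not at this
  exact (this n).trans (by gcongr)

end IsStationaryFlow

/-! ### The uniform flow and the harmonic flow, with their stationary measures -/

/-- The flow rule of the nonbacktracking walk: all children are equally likely. -/
noncomputable def uniformFlow (_ : ℕ) (T : List ℕ → ℕ) : ℝ := 1 / T []

/-- The flow rule of the ray to which simple random walk converges. -/
noncomputable def harmonicFlow (i : ℕ) (T : List ℕ → ℕ) : ℝ :=
  conductance (subtree T [i]) / rootConductance T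

/-- The effective conductance between the two ends when the roots of `T` and `T'` are joined by an
edge. -/
noncomputable def joinConductance (T T' : List ℕ → ℕ) : ℝ :=
  rootConductance T * rootConductance T' /
    (rootConductance T + rootConductance T' + rootConductance T * rootConductance T')

/-- The density, with respect to the Galton–Watson measure, of the stationary measure of the
harmonic flow. -/
noncomputable def harmonicDensity (ν : Measure ℕ) (T : List ℕ → ℕ) : ENNReal :=
  ∫⁻ T', ENNReal.ofReal (joinConductance T T') ∂(gwMeasure ν)

/-- The stationary measure of the harmonic flow. Its total mass is not `1`: the normalization is
that of `lintegral_timePerLevel`. -/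
noncomputable def harmonicMeasure (ν : Measure ℕ) : Measure (List ℕ → ℕ) :=
  (gwMeasure ν).withDensity (harmonicDensity ν)

lemma joinConductance_eq_left {T T' : List ℕ → ℕ} (hT' : 0 < rootConductance T') :
    joinConductance T T' =
      rootConductance T * conductance T' / (rootConductance T + conductance T') := by
  have := rootConductance_nonneg T
  rw [joinConductance, conductance_eq T']; field_simp; ring_nf

lemma joinConductance_eq_right {T T' : List ℕ → ℕ} (hT : 0 < rootConductance T) :
    joinConductance T T' =
      conductance T * rootConductance T' / (conductance T + rootConductance T') := by
  have := rootConductance_nonneg T'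
  rw [joinConductance, conductance_eq T]; field_simp; ring_nf

lemma joinConductance_nonneg (T T' : List ℕ → ℕ) : 0 ≤ joinConductance T T' := by
  have := rootConductance_nonneg T
  have := rootConductance_nonneg T'
  rw [joinConductance]; positivity

lemma joinConductance_le_one (T T' : List ℕ → ℕ) : joinConductance T T' ≤ 1 := by
  have h1 := rootConductance_nonneg T
  have h2 := rootConductance_nonneg T'
  exact div_le_one_of_le₀ (by linarith) (by positivity)

lemma joinConductance_lt_one {T : List ℕ → ℕ} (hT : 0 < rootConductance T) (T' : List ℕ → ℕ) :
    joinConductance T T' < 1 := by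
  have h2 := rootConductance_nonneg T'
  rw [joinConductance, div_lt_one (by positivity)]; linarith

lemma measurable_joinConductance :
    Measurable fun z : (List ℕ → ℕ) × (List ℕ → ℕ) => joinConductance z.1 z.2 := by
  have h1 : Measurable fun z : (List ℕ → ℕ) × (List ℕ → ℕ) => rootConductance z.1 :=
    measurable_rootConductance.comp measurable_fst
  have h2 : Measurable fun z : (List ℕ → ℕ) × (List ℕ → ℕ) => rootConductance z.2 :=
    measurable_rootConductance.comp measurable_snd
  exact (h1.mul h2).div ((h1.add h2).add (h1.mul h2))

lemma measurable_joinConductance_right (T : List ℕ → ℕ) :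
    Measurable fun T' => joinConductance T T' := by
  have h := measurable_rootConductance
  unfold joinConductance
  exact (h.const_mul _).div ((h.const_add _).add (h.const_mul _))

lemma measurable_joinConductance_mul {g : (List ℕ → ℕ) → ENNReal} (hg : Measurable g) :
    Measurable fun z : (List ℕ → ℕ) × (List ℕ → ℕ) =>
      ENNReal.ofReal (joinConductance z.1 z.2) * g z.1 :=
  measurable_joinConductance.ennreal_ofReal.mul (hg.comp measurable_fst)

section Stationary

variable (ν : Measure ℕ) [IsProbabilityMeasure ν]

/-- Exchanging the label of the child `i` with some other label does not change the mean of a sum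
over the children. -/
lemma lintegral_sum_children_swap {F : ℕ → (List ℕ → ℕ) → ENNReal} (hF : ∀ i, Measurable (F i))
    (j : ℕ → ℕ) :
    ∫⁻ T, ∑ i ∈ Finset.range (T []), F i T ∂(gwMeasure ν) =
      ∫⁻ T, ∑ i ∈ Finset.range (T []), F i (swapTree (j i) T) ∂(gwMeasure ν) := by
  have key : ∀ G : ℕ → (List ℕ → ℕ) → ENNReal, (∀ i, Measurable (G i)) →
      ∫⁻ T, ∑ i ∈ Finset.range (T []), G i T ∂(gwMeasure ν) =
        ∑' i, ∫⁻ T, (if i < T [] then G i T else 0) ∂(gwMeasure ν) := by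
    intro G hG
    rw [← lintegral_tsum]
    · refine lintegral_congr fun T => ?_
      rw [tsum_eq_sum (s := Finset.range (T []))]
      · exact Finset.sum_congr rfl fun i hi => by rw [if_pos (Finset.mem_range.mp hi)]
      · intro i hi
        rw [if_neg (by simpa using hi)]
    · intro i
      exact (Measurable.ite (measurableSet_lt measurable_const (measurable_pi_apply _)) (hG i)
        measurable_const).aemeasurable
  rw [key F hF, key (fun i T => F i (swapTree (j i) T)) fun i =>
    (hF i).comp (measurePreserving_swapTree ν (j i)).measurable]
  refine tsum_congr fun i => ?_
  rw [← (measurePreserving_swapTree ν (j i)).lintegral_comp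
    (Measurable.ite (measurableSet_lt measurable_const (measurable_pi_apply _)) (hF i)
      measurable_const)]
  rfl

lemma isStationaryFlow_uniformFlow (hν : ∀ᵐ n ∂ν, 2 ≤ n) :
    IsStationaryFlow ν uniformFlow (gwMeasure ν) where
  measurable i := by unfold uniformFlow; fun_prop
  nonneg i T := by unfold uniformFlow; positivity
  pos T hT i _ := by
    have := hT.two_le_cast []
    unfold uniformFlow; positivity
  sum_eq_one T hT := by
    have := hT.two_le_cast []
    simp only [uniformFlow, Finset.sum_const, Finset.card_range, nsmul_eq_mul]
    field_simp
  absolutelyContinuous := .rfl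
  absolutelyContinuous' := .rfl
  lintegral_eq g hg := by
    have hm : ∀ i, Measurable fun T => ENNReal.ofReal (uniformFlow i T) * g (subtree T [i]) :=
      fun i => (by unfold uniformFlow; fun_prop : Measurable (uniformFlow i)).ennreal_ofReal.mul
        (hg.comp (measurable_subtree [i]))
    rw [lintegral_sum_children_swap ν hm id,
      ← (measurePreserving_subtree ν [0]).lintegral_comp hg]
    refine lintegral_congr_ae ?_
    filter_upwards [ae_atLeastBinary ν hν] with T hT
    have h2 := hT.two_le_cast []
    have : ∀ i, ENNReal.ofReal (uniformFlow i (swapTree (id i) T)) *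
        g (subtree (swapTree (id i) T) [i]) =
        ENNReal.ofReal (uniformFlow 0 T) * g (subtree T [0]) := by
      intro i
      rw [subtree_swapTree, id, Equiv.swap_apply_right]; rfl
    rw [Finset.sum_congr rfl fun i _ => this i, ← Finset.sum_mul]
    rw [← ENNReal.ofReal_sum_of_nonneg fun i _ => by unfold uniformFlow; positivity]
    simp only [uniformFlow, Finset.sum_const, Finset.card_range, nsmul_eq_mul]
    rw [mul_one_div_cancel (by linarith), ENNReal.ofReal_one, one_mul]

lemma measurable_harmonicDensity : Measurable (harmonicDensity ν) :=
  measurable_joinConductance.ennreal_ofReal.lintegral_prod_right'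

lemma harmonicDensity_le_one (T : List ℕ → ℕ) : harmonicDensity ν T ≤ 1 := by
  calc harmonicDensity ν T ≤ ∫⁻ _, 1 ∂(gwMeasure ν) := lintegral_mono fun T' =>
        ENNReal.ofReal_le_one.mpr (joinConductance_le_one T T')
    _ = 1 := by simp

lemma harmonicMeasure_le : harmonicMeasure ν ≤ gwMeasure ν := by
  calc harmonicMeasure ν ≤ (gwMeasure ν).withDensity 1 :=
        withDensity_mono (Eventually.of_forall (harmonicDensity_le_one ν))
    _ = gwMeasure ν := withDensity_one

instance : IsFiniteMeasure (harmonicMeasure ν) := isFiniteMeasure_of_le _ (harmonicMeasure_le ν)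

lemma lintegral_harmonicMeasure_fst {g : (List ℕ → ℕ) → ENNReal} (hg : Measurable g) :
    ∫⁻ T, g T ∂(harmonicMeasure ν) = ∫⁻ z, ENNReal.ofReal (joinConductance z.1 z.2) * g z.1
      ∂((gwMeasure ν).prod (gwMeasure ν)) := by
  rw [harmonicMeasure, lintegral_withDensity_eq_lintegral_mul _ (measurable_harmonicDensity ν) hg,
    lintegral_prod _ (measurable_joinConductance_mul hg).aemeasurable]
  refine lintegral_congr fun T => ?_
  rw [Pi.mul_apply, harmonicDensity]
  exact (lintegral_mul_const _ (measurable_joinConductance_right T).ennreal_ofReal).symm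

lemma lintegral_harmonicMeasure_snd {g : (List ℕ → ℕ) → ENNReal} (hg : Measurable g) :
    ∫⁻ T, g T ∂(harmonicMeasure ν) = ∫⁻ z, ENNReal.ofReal (joinConductance z.2 z.1) * g z.2
      ∂((gwMeasure ν).prod (gwMeasure ν)) := by
  rw [lintegral_harmonicMeasure_fst ν hg, ← Measure.measurePreserving_swap.lintegral_comp
    (measurable_joinConductance_mul hg)]
  rfl

lemma ae_prod_atLeastBinary (hν : ∀ᵐ n ∂ν, 2 ≤ n) :
    ∀ᵐ z ∂((gwMeasure ν).prod (gwMeasure ν)), AtLeastBinary z.1 ∧ AtLeastBinary z.2 :=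
  (Measure.quasiMeasurePreserving_fst.ae (ae_atLeastBinary ν hν)).and
    (Measure.quasiMeasurePreserving_snd.ae (ae_atLeastBinary ν hν))

/-- The total conductance of the children `0, …, D` of the root, one more than it has. -/
noncomputable def extendedConductance (T : List ℕ → ℕ) : ℝ :=
  ∑ j ∈ Finset.range (T [] + 1), conductance (subtree T [j])

lemma extendedConductance_graft (z : (List ℕ → ℕ) × (List ℕ → ℕ)) :
    extendedConductance (graft z) = conductance z.1 + rootConductance z.2 := by
  rw [extendedConductance, Finset.sum_range_succ', subtree_graft_zero, add_comm, graft_nil,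
    rootConductance]
  simp_rw [subtree_graft_succ]

lemma extendedConductance_swapTree {i : ℕ} {T : List ℕ → ℕ} (hi : i < T []) :
    extendedConductance (swapTree (i + 1) T) = extendedConductance T := by
  simp only [extendedConductance, subtree_swapTree, swapTree_nil]
  refine Finset.sum_equiv (Equiv.swap 0 (i + 1)) (fun j => ?_) fun j _ => rfl
  simp only [Finset.mem_range, Equiv.swap_apply_def]
  split_ifs <;> omega

lemma measurable_extendedConductance : Measurable extendedConductance := by
  have h : extendedConductance = fun T => rootConductance T + conductance (subtree T [T []]) := by
    funext T; rw [extendedConductance, Finset.sum_range_succ, rootConductance]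
  rw [h]
  refine measurable_rootConductance.add ?_
  have h' : Measurable fun q : ℕ × (List ℕ → ℕ) => conductance (subtree q.2 [q.1]) :=
    measurable_from_prod_countable_right fun n =>
      measurable_conductance.comp (measurable_subtree [n])
  have h'' : Measurable fun T : List ℕ → ℕ => (T [], T) := by fun_prop
  exact h'.comp h''

lemma measurable_conductance_subtree (x : List ℕ) :
    Measurable fun T => conductance (subtree T x) :=
  measurable_conductance.comp (measurable_subtree x)

lemma measurable_harmonicFlow (i : ℕ) : Measurable (harmonicFlow i) :=
  (measurable_conductance_subtree [i]).div measurable_rootConductance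

/-- Both sides are the mean flow through the children of the root of a tree with one additional
child at the root, the additional child being where the flow comes from or where it goes to. -/
lemma lintegral_harmonicFlow (hν : ∀ᵐ n ∂ν, 2 ≤ n) {g : (List ℕ → ℕ) → ENNReal}
    (hg : Measurable g) :
    ∫⁻ T, ∑ i ∈ Finset.range (T []), ENNReal.ofReal (harmonicFlow i T) * g (subtree T [i])
      ∂(harmonicMeasure ν) = ∫⁻ T, g T ∂(harmonicMeasure ν) := by
  have hGm : ∀ i, Measurable fun T => ENNReal.ofReal (harmonicFlow i T) * g (subtree T [i]) :=
    fun i => (measurable_harmonicFlow i).ennreal_ofReal.mul (hg.comp (measurable_subtree [i]))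
  rw [lintegral_harmonicMeasure_snd ν (measurable_sum_children hGm),
    lintegral_harmonicMeasure_fst ν hg]
  set F : ℕ → (List ℕ → ℕ) → ENNReal := fun i U =>
    ENNReal.ofReal (conductance (subtree U [i + 1]) * conductance (subtree U [0]) /
      extendedConductance U) * g (subtree U [i + 1]) with hF
  have hFm : ∀ i, Measurable (F i) := fun i =>
    (((measurable_conductance_subtree [i + 1]).mul (measurable_conductance_subtree [0])).div
      measurable_extendedConductance).ennreal_ofReal.mul (hg.comp (measurable_subtree [i + 1]))
  have hFsm : ∀ i, Measurable fun U => F i (swapTree (i + 1) U) := fun i =>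
    (hFm i).comp (measurePreserving_swapTree ν (i + 1)).measurable
  have hsw := lintegral_sum_children_swap ν hFm (fun i => i + 1)
  rw [← (measurePreserving_graft ν).lintegral_comp (measurable_sum_children hFm),
    ← (measurePreserving_graft ν).lintegral_comp (measurable_sum_children hFsm)] at hsw
  convert hsw using 1
  · refine lintegral_congr_ae ?_
    filter_upwards [ae_prod_atLeastBinary ν hν] with z hz
    have hS1 := hz.1.one_le_rootConductance
    have hS2 := hz.2.one_le_rootConductance
    have hc1 := conductance_nonneg z.1
    rw [Finset.mul_sum, graft_nil]
    refine Finset.sum_congr rfl fun i _ => ?_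
    simp only [hF]
    rw [extendedConductance_graft, subtree_graft_zero, subtree_graft_succ, ← mul_assoc,
      ← ENNReal.ofReal_mul (joinConductance_nonneg _ _),
      joinConductance_eq_left (by linarith), harmonicFlow]
    congr 2
    field_simp
    ring
  · refine lintegral_congr_ae ?_
    filter_upwards [ae_prod_atLeastBinary ν hν] with z hz
    have hS1 := hz.1.one_le_rootConductance
    have hS2 := hz.2.one_le_rootConductance
    have hc1 := conductance_nonneg z.1
    have : ∀ i ∈ Finset.range (graft z []), F i (swapTree (i + 1) (graft z)) =
        ENNReal.ofReal (conductance (subtree z.2 [i]) * (conductance z.1 /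
          (conductance z.1 + rootConductance z.2))) * g z.1 := by
      intro i hi
      simp only [hF]
      rw [extendedConductance_swapTree (Finset.mem_range.mp hi), subtree_swapTree,
        subtree_swapTree, Equiv.swap_apply_right, Equiv.swap_apply_left, subtree_graft_zero,
        subtree_graft_succ, extendedConductance_graft]
      congr 2; ring
    rw [Finset.sum_congr rfl this, ← Finset.sum_mul, ← ENNReal.ofReal_sum_of_nonneg
      fun i _ => mul_nonneg (conductance_nonneg _) (by positivity), ← Finset.sum_mul, graft_nil,
      joinConductance_eq_right (by linarith)]
    congr 2
    rw [← rootConductance]; ring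

lemma isStationaryFlow_harmonicFlow (hν : ∀ᵐ n ∂ν, 2 ≤ n) :
    IsStationaryFlow ν harmonicFlow (harmonicMeasure ν) where
  measurable := measurable_harmonicFlow
  nonneg i T := div_nonneg (conductance_nonneg _) (rootConductance_nonneg _)
  pos T hT i _ := div_pos (by linarith [(hT.subtree [i]).half_le_conductance])
    (by linarith [hT.one_le_rootConductance])
  sum_eq_one T hT := by
    simp only [harmonicFlow]
    rw [← Finset.sum_div, ← rootConductance, div_self (by linarith [hT.one_le_rootConductance])]
  absolutelyContinuous := withDensity_absolutelyContinuous _ _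
  absolutelyContinuous' := by
    refine withDensity_absolutelyContinuous' (measurable_harmonicDensity ν).aemeasurable ?_
    filter_upwards [ae_atLeastBinary ν hν] with T hT
    rw [harmonicDensity, Ne, lintegral_eq_zero_iff
      (measurable_joinConductance_right T).ennreal_ofReal]
    intro h
    obtain ⟨T', h1, h2⟩ := (h.and (ae_atLeastBinary ν hν)).exists
    have hS1 := hT.one_le_rootConductance
    have hS2 := h2.one_le_rootConductance
    have : 0 < joinConductance T T' := by rw [joinConductance]; positivity
    simp only [Pi.zero_apply, ENNReal.ofReal_eq_zero] at h1
    exact absurd h1 (not_le.mpr this)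
  lintegral_eq _ hg := lintegral_harmonicFlow ν hν hg

/-- The number of neighbours of a vertex (other than the root of the whole tree) over the conductance
of the tree `T` below it. Multiplied by the probability that the limiting ray of simple random walk
passes through the vertex, it is the mean time that the walk spends at the vertex. -/
noncomputable def timePerLevel (T : List ℕ → ℕ) : ℝ := (T [] + 1) / rootConductance T

lemma timePerLevel_nonneg (T : List ℕ → ℕ) : 0 ≤ timePerLevel T :=
  div_nonneg (by positivity) (rootConductance_nonneg T)

lemma AtLeastBinary.timePerLevel_le {T : List ℕ → ℕ} (hT : AtLeastBinary T) :
    timePerLevel T ≤ 3 := by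
  have h1 := hT.half_le_rootConductance
  have h2 := hT.two_le_cast []
  rw [timePerLevel, div_le_iff₀ (by linarith)]; linarith

lemma measurable_timePerLevel : Measurable timePerLevel := by
  have : Measurable fun T : List ℕ → ℕ => (T [] : ℝ) + 1 := by fun_prop
  exact this.div measurable_rootConductance

/-- Among the `D + 1` children of the root of a tree with one additional child, the additional one
carries on average a fraction `1 / (D + 1)` of the conductance. -/
lemma lintegral_timePerLevel (hν : ∀ᵐ n ∂ν, 2 ≤ n) :
    ∫⁻ T, ENNReal.ofReal (timePerLevel T) ∂(harmonicMeasure ν) = 1 := by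
  rw [lintegral_harmonicMeasure_snd ν measurable_timePerLevel.ennreal_ofReal]
  set F : ℕ → (List ℕ → ℕ) → ENNReal := fun i U =>
    ENNReal.ofReal (conductance (subtree U [i]) / extendedConductance U) with hF
  have hFm : ∀ i, Measurable (F i) := fun i =>
    ((measurable_conductance_subtree [i]).div measurable_extendedConductance).ennreal_ofReal
  have hsw := lintegral_sum_children_swap ν (fun i => hFm (i + 1)) (fun i => i + 1)
  have h1 : ∫⁻ U, (F 0 U + ∑ i ∈ Finset.range (U []), F (i + 1) U) ∂(gwMeasure ν) = 1 := by
    have : ∀ᵐ U ∂(gwMeasure ν), F 0 U + ∑ i ∈ Finset.range (U []), F (i + 1) U = 1 := by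
      filter_upwards [ae_atLeastBinary ν hν] with U hU
      rw [add_comm, ← Finset.sum_range_succ' (fun i => F i U)]
      simp only [hF]
      have h0 : 0 < extendedConductance U :=
        lt_of_lt_of_le (b := conductance (subtree U [0]))
          (by linarith [(hU.subtree [0]).half_le_conductance])
          (Finset.single_le_sum (f := fun j => conductance (subtree U [j]))
            (fun j _ => conductance_nonneg _) (Finset.mem_range.mpr (Nat.succ_pos _)))
      rw [← ENNReal.ofReal_sum_of_nonneg fun i _ =>
        div_nonneg (conductance_nonneg _) h0.le, ← Finset.sum_div, ← extendedConductance,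
        div_self h0.ne', ENNReal.ofReal_one]
    rw [lintegral_congr_ae this]; simp
  have hm : Measurable fun U => F 0 U +
      ∑ i ∈ Finset.range (U []), F (i + 1) (swapTree (i + 1) U) :=
    (hFm 0).add (measurable_sum_children fun i =>
      (hFm (i + 1)).comp (measurePreserving_swapTree ν (i + 1)).measurable)
  rw [lintegral_add_left (hFm 0), hsw, ← lintegral_add_left (hFm 0),
    ← (measurePreserving_graft ν).lintegral_comp hm] at h1
  rw [← h1]
  refine lintegral_congr_ae ?_
  filter_upwards [ae_prod_atLeastBinary ν hν] with z hz
  have hS1 := hz.1.one_le_rootConductance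
  have hS2 := hz.2.one_le_rootConductance
  have hc1 := conductance_nonneg z.1
  have : ∀ i ∈ Finset.range (graft z []), F (i + 1) (swapTree (i + 1) (graft z)) =
      F 0 (graft z) := by
    intro i hi
    simp only [hF]
    rw [extendedConductance_swapTree (Finset.mem_range.mp hi), subtree_swapTree,
      Equiv.swap_apply_right]
  rw [Finset.sum_congr rfl this, Finset.sum_const, Finset.card_range, graft_nil, nsmul_eq_mul]
  simp only [hF]
  rw [extendedConductance_graft, subtree_graft_zero,
    ← ENNReal.ofReal_mul (joinConductance_nonneg _ _), joinConductance_eq_left (by linarith),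
    ← ENNReal.ofReal_natCast, ← ENNReal.ofReal_mul (by positivity),
    ← ENNReal.ofReal_add (by positivity) (by positivity), timePerLevel]
  congr 1
  field_simp
  ring

end Stationary

/-! ### The entropy rates -/

lemma log_sq_le {y : ℝ} (hy : 1 ≤ y) : Real.log y ^ 2 ≤ 4 * y := by
  have h1 : Real.log y = 2 * Real.log (√y) := by rw [Real.log_sqrt (by linarith)]; ring
  have h2 : Real.log (√y) ≤ √y - 1 := Real.log_le_sub_one_of_pos (by positivity)
  have h3 : 0 ≤ Real.log (√y) := Real.log_nonneg (Real.one_le_sqrt.mpr hy)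
  have h4 : √y * √y = y := Real.mul_self_sqrt (by linarith)
  nlinarith

section Rates

variable (ν : Measure ℕ) [IsProbabilityMeasure ν]

/-- The asymptotic entropy of simple random walk. -/
noncomputable def walkEntropyRate : ℝ :=
  ∫ T, Real.log (1 + rootConductance T) ∂(harmonicMeasure ν)

lemma integrable_children (hint : Integrable (fun n : ℕ => (n : ℝ)) ν) :
    Integrable (fun T : List ℕ → ℕ => (T [] : ℝ)) (gwMeasure ν) :=
  (measurePreserving_apply ν []).integrable_comp_of_integrable hint

lemma memLp_two_of_log {f : (List ℕ → ℕ) → ℝ} (hf : Measurable f)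
    (hint : Integrable (fun n : ℕ => (n : ℝ)) ν)
    (h : ∀ᵐ T ∂(gwMeasure ν), 1 ≤ f T ∧ f T ≤ 1 + T []) :
    MemLp (fun T => Real.log (f T)) 2 (gwMeasure ν) := by
  rw [memLp_two_iff_integrable_sq hf.log.aestronglyMeasurable]
  refine Integrable.mono' (((integrable_const 1).add (integrable_children ν hint)).const_mul 4)
    (hf.log.pow_const 2).aestronglyMeasurable ?_
  filter_upwards [h] with T hT
  rw [Real.norm_eq_abs, abs_of_nonneg (sq_nonneg _)]
  refine (log_sq_le hT.1).trans ?_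
  simp only [Pi.add_apply]; linarith [hT.2]

lemma memLp_log_children (hν : ∀ᵐ n ∂ν, 2 ≤ n) (hint : Integrable (fun n : ℕ => (n : ℝ)) ν) :
    MemLp (fun T : List ℕ → ℕ => Real.log (T [])) 2 (gwMeasure ν) := by
  refine memLp_two_of_log ν (f := fun T => (T [] : ℝ)) (by fun_prop) hint ?_
  filter_upwards [ae_atLeastBinary ν hν] with T hT
  exact ⟨by linarith [hT.two_le_cast []], by linarith⟩

lemma memLp_log_one_add_rootConductance
    (hint : Integrable (fun n : ℕ => (n : ℝ)) ν) :
    MemLp (fun T => Real.log (1 + rootConductance T)) 2 (harmonicMeasure ν) := by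
  refine (memLp_two_of_log ν (f := fun T => 1 + rootConductance T)
    (measurable_rootConductance.const_add 1) hint ?_).mono_measure (harmonicMeasure_le ν)
  filter_upwards with T
  exact ⟨by linarith [rootConductance_nonneg T], by linarith [rootConductance_le T]⟩

lemma memLp_log_rootConductance (hν : ∀ᵐ n ∂ν, 2 ≤ n)
    (hint : Integrable (fun n : ℕ => (n : ℝ)) ν) :
    MemLp (fun T => Real.log (rootConductance T)) 2 (harmonicMeasure ν) := by
  refine (memLp_two_of_log ν measurable_rootConductance hint ?_).mono_measure
    (harmonicMeasure_le ν)
  filter_upwards [ae_atLeastBinary ν hν] with T hT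
  exact ⟨hT.one_le_rootConductance, by linarith [rootConductance_le T]⟩

lemma memLp_timePerLevel (hν : ∀ᵐ n ∂ν, 2 ≤ n) :
    MemLp timePerLevel 2 (harmonicMeasure ν) := by
  refine MemLp.of_bound measurable_timePerLevel.aestronglyMeasurable 3 ?_
  filter_upwards [(isStationaryFlow_harmonicFlow ν hν).ae_atLeastBinary hν] with T hT
  rw [Real.norm_eq_abs, abs_of_nonneg (timePerLevel_nonneg T)]
  exact hT.timePerLevel_le

lemma integral_timePerLevel (hν : ∀ᵐ n ∂ν, 2 ≤ n) :
    ∫ T, timePerLevel T ∂(harmonicMeasure ν) = 1 := by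
  rw [integral_eq_lintegral_of_nonneg_ae (Eventually.of_forall timePerLevel_nonneg)
    measurable_timePerLevel.aestronglyMeasurable, lintegral_timePerLevel ν hν,
    ENNReal.toReal_one]

/-- The entropy of a step of the harmonic flow is at most that of a uniform step. The entropy of
the step is written through `rootConductance` with the help of `conductance_eq`. -/
lemma entropy_harmonicFlow_le {T : List ℕ → ℕ} (hT : AtLeastBinary T) :
    Real.log (rootConductance T) +
      (flowAvg harmonicFlow (fun T => Real.log (1 + rootConductance T)) T -
        flowAvg harmonicFlow (fun T => Real.log (rootConductance T)) T) ≤ Real.log (T []) := by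
  have hS := hT.one_le_rootConductance
  have hD := hT.two_le_cast []
  have hc : ∀ i, 0 < conductance (subtree T [i]) := fun i => by
    linarith [(hT.subtree [i]).half_le_conductance]
  have hsum : ∑ i ∈ Finset.range (T []), harmonicFlow i T = 1 := by
    simp only [harmonicFlow]
    rw [← Finset.sum_div, ← rootConductance, div_self (by linarith)]
  have h1 : ∀ i, harmonicFlow i T * (Real.log (rootConductance T) +
      (Real.log (1 + rootConductance (subtree T [i])) -
        Real.log (rootConductance (subtree T [i]))) - Real.log (T [])) ≤
      1 / T [] - harmonicFlow i T := by
    intro i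
    have hSi := (hT.subtree [i]).one_le_rootConductance
    have hp : 0 < harmonicFlow i T := div_pos (hc i) (by linarith)
    have h2 : Real.log (rootConductance T) + (Real.log (1 + rootConductance (subtree T [i])) -
        Real.log (rootConductance (subtree T [i]))) - Real.log (T []) =
        Real.log (1 / (T [] * harmonicFlow i T)) := by
      rw [harmonicFlow, conductance_eq, one_div, Real.log_inv, Real.log_mul (by linarith)
        (by positivity), Real.log_div (by positivity) (by linarith),
        Real.log_div (by linarith) (by linarith)]
      ring
    rw [h2]
    calc harmonicFlow i T * Real.log (1 / (T [] * harmonicFlow i T))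
        ≤ harmonicFlow i T * (1 / (T [] * harmonicFlow i T) - 1) :=
          mul_le_mul_of_nonneg_left (Real.log_le_sub_one_of_pos (by positivity)) hp.le
      _ = 1 / T [] - harmonicFlow i T := by field_simp
  have h3 := Finset.sum_le_sum fun i (_ : i ∈ Finset.range (T [])) => h1 i
  rw [Finset.sum_sub_distrib, hsum, Finset.sum_const, Finset.card_range, nsmul_eq_mul,
    mul_one_div_cancel (by linarith), sub_self] at h3
  have h4 : ∑ i ∈ Finset.range (T []), harmonicFlow i T * (Real.log (rootConductance T) +
      (Real.log (1 + rootConductance (subtree T [i])) -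
        Real.log (rootConductance (subtree T [i]))) - Real.log (T [])) =
      (Real.log (rootConductance T) - Real.log (T [])) *
        (∑ i ∈ Finset.range (T []), harmonicFlow i T) +
      (flowAvg harmonicFlow (fun T => Real.log (1 + rootConductance T)) T -
        flowAvg harmonicFlow (fun T => Real.log (rootConductance T)) T) := by
    simp only [flowAvg]
    rw [Finset.mul_sum, ← Finset.sum_sub_distrib, ← Finset.sum_add_distrib]
    exact Finset.sum_congr rfl fun i _ => by ring
  rw [h4, hsum] at h3
  linarith

lemma walkEntropyRate_le (hν : ∀ᵐ n ∂ν, 2 ≤ n) (hint : Integrable (fun n : ℕ => (n : ℝ)) ν) :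
    walkEntropyRate ν ≤ ∫ T, Real.log (T []) ∂(harmonicMeasure ν) := by
  have hp := isStationaryFlow_harmonicFlow ν hν
  have m1 : Measurable fun T => Real.log (1 + rootConductance T) :=
    (measurable_rootConductance.const_add 1).log
  have m2 : Measurable fun T => Real.log (rootConductance T) := measurable_rootConductance.log
  have i1 := (memLp_log_one_add_rootConductance ν hint).integrable one_le_two
  have i2 := (memLp_log_rootConductance ν hν hint).integrable one_le_two
  have i3 := ((memLp_log_children ν hν hint).mono_measure (harmonicMeasure_le ν)).integrable
    one_le_two
  have q1 := hp.integrable_flowAvg m1 i1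
  have q2 := hp.integrable_flowAvg m2 i2
  have h := integral_mono_ae (i2.add (q1.sub q2)) i3
    ((hp.ae_atLeastBinary hν).mono fun T hT => entropy_harmonicFlow_le hT)
  have e : ∫ T, ((fun T => Real.log (rootConductance T)) +
      (flowAvg harmonicFlow (fun T => Real.log (1 + rootConductance T)) -
        flowAvg harmonicFlow (fun T => Real.log (rootConductance T)))) T ∂(harmonicMeasure ν) =
      walkEntropyRate ν := by
    rw [integral_add' i2 (q1.sub q2), integral_sub' q1 q2, hp.integral_flowAvg m1 i1,
      hp.integral_flowAvg m2 i2, walkEntropyRate]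
    ring
  rw [← e]; exact h

lemma harmonicDensity_lt_one {T : List ℕ → ℕ} (hT : AtLeastBinary T) :
    harmonicDensity ν T < 1 := by
  have h : ∫⁻ T', ENNReal.ofReal (joinConductance T T') ∂(gwMeasure ν) <
      ∫⁻ _, 1 ∂(gwMeasure ν) := by
    refine lintegral_strict_mono (IsProbabilityMeasure.ne_zero _) aemeasurable_const ?_
      (Eventually.of_forall fun T' => ENNReal.ofReal_lt_one.mpr
        (joinConductance_lt_one (by linarith [hT.one_le_rootConductance]) T'))
    exact ne_top_of_le_ne_top ENNReal.one_ne_top (harmonicDensity_le_one ν T)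
  simpa [harmonicDensity] using h

/-- The stationary measure of the harmonic flow is strictly smaller than the Galton–Watson measure:
with time as the clock, the walk spends some of its steps going back. -/
lemma integral_log_children_harmonicMeasure_lt (hν : ∀ᵐ n ∂ν, 2 ≤ n)
    (hint : Integrable (fun n : ℕ => (n : ℝ)) ν) :
    ∫ T, Real.log (T []) ∂(harmonicMeasure ν) < ∫ T, Real.log (T []) ∂(gwMeasure ν) := by
  have hi := (memLp_log_children ν hν hint).integrable one_le_two
  have hfin : ∀ᵐ T ∂(gwMeasure ν), harmonicDensity ν T < ⊤ := Eventually.of_forall fun T =>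
    (harmonicDensity_le_one ν T).trans_lt ENNReal.one_lt_top
  have hd1 : ∀ T, (harmonicDensity ν T).toReal ≤ 1 := fun T =>
    ENNReal.toReal_le_of_le_ofReal zero_le_one (by simpa using harmonicDensity_le_one ν T)
  have hi2 : Integrable (fun T => (harmonicDensity ν T).toReal * Real.log (T []))
      (gwMeasure ν) := by
    refine hi.bdd_mul (c := 1) (measurable_harmonicDensity ν).ennreal_toReal.aestronglyMeasurable
      (Eventually.of_forall fun T => ?_)
    rw [Real.norm_eq_abs, abs_of_nonneg ENNReal.toReal_nonneg]
    exact hd1 T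
  rw [harmonicMeasure, integral_withDensity_eq_integral_toReal_smul
    (measurable_harmonicDensity ν) hfin]
  simp only [smul_eq_mul]
  rw [← sub_pos, ← integral_sub hi hi2]
  have hpos : ∀ᵐ T ∂(gwMeasure ν),
      0 < Real.log (T []) - (harmonicDensity ν T).toReal * Real.log (T []) := by
    filter_upwards [ae_atLeastBinary ν hν] with T hT
    have h1 : 0 < Real.log (T []) := Real.log_pos (by linarith [hT.two_le_cast []])
    have h2 : (harmonicDensity ν T).toReal < 1 := by
      rw [← ENNReal.toReal_one]
      exact (ENNReal.toReal_lt_toReal (by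
        exact ((harmonicDensity_le_one ν T).trans_lt ENNReal.one_lt_top).ne)
        ENNReal.one_ne_top).mpr (harmonicDensity_lt_one ν hT)
    nlinarith
  rw [integral_pos_iff_support_of_nonneg_ae (hpos.mono fun T h => h.le) (hi.sub hi2)]
  refine pos_iff_ne_zero.mpr fun h0 => ?_
  have hne : ∀ᵐ T ∂(gwMeasure ν), T ∉ Function.support
      (fun T : List ℕ → ℕ => Real.log (T []) - (harmonicDensity ν T).toReal * Real.log (T [])) :=
    measure_eq_zero_iff_ae_notMem.mp h0
  obtain ⟨T, h1, h2⟩ := (hpos.and hne).exists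
  exact h2 h1.ne'

lemma integral_log_children :
    ∫ T, Real.log (T []) ∂(gwMeasure ν) = ∫ n, Real.log n ∂ν := by
  have h := measurePreserving_apply ν []
  have e := integral_map (μ := gwMeasure ν) (f := fun n : ℕ => Real.log n) h.measurable.aemeasurable
    Measurable.of_discrete.aestronglyMeasurable
  rw [h.map_eq] at e
  exact e.symm

lemma walkEntropyRate_lt (hν : ∀ᵐ n ∂ν, 2 ≤ n) (hint : Integrable (fun n : ℕ => (n : ℝ)) ν) :
    walkEntropyRate ν < ∫ T, Real.log (T []) ∂(gwMeasure ν) :=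
  (walkEntropyRate_le ν hν hint).trans_lt (integral_log_children_harmonicMeasure_lt ν hν hint)

end Rates

/-! ### Simple random walk on a fixed tree: Green function and martingales -/

/-- The degree of a vertex. -/
def vertexDegree (T : List ℕ → ℕ) : List ℕ → ℝ
  | [] => T []
  | i :: x => T (i :: x) + 1

/-- The sum of `h` over the neighbours of a vertex. -/
def neighborSum (T : List ℕ → ℕ) (h : List ℕ → ℝ) : List ℕ → ℝ
  | [] => ∑ i ∈ Finset.range (T []), h [i]
  | j :: x => ∑ i ∈ Finset.range (T (j :: x)), h (i :: j :: x) + h x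

/-- The density of the law of simple random walk after `t` steps with respect to the degree. It is
meaningful at the vertices of the tree only. -/
noncomputable def walkDensity (T : List ℕ → ℕ) : ℕ → List ℕ → ℝ
  | 0 => fun x => if x = [] then 1 / vertexDegree T [] else 0
  | t + 1 => fun x => neighborSum T (walkDensity T t) x / vertexDegree T x

/-- The mean of `φ` at the position of simple random walk after `t` steps. -/
noncomputable def walkMean (T : List ℕ → ℕ) (t : ℕ) (φ : List ℕ → ℝ) : ℝ :=
  ∑ n ∈ Finset.range (t + 1), ∑ x ∈ level T n, vertexDegree T x * walkDensity T t x * φ x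

/-- The sum of `g` over the subtrees at the strict ancestors of a vertex. -/
def pathSum (g : (List ℕ → ℕ) → ℝ) (T : List ℕ → ℕ) : List ℕ → ℝ
  | [] => 0
  | _ :: x => pathSum g T x + g (subtree T x)

lemma vertexDegree_le (T : List ℕ → ℕ) (x : List ℕ) : vertexDegree T x ≤ T x + 1 := by
  cases x <;> simp [vertexDegree]

lemma le_vertexDegree (T : List ℕ → ℕ) (x : List ℕ) : (T x : ℝ) ≤ vertexDegree T x := by
  cases x <;> simp [vertexDegree]

lemma vertexDegree_nonneg (T : List ℕ → ℕ) (x : List ℕ) : 0 ≤ vertexDegree T x :=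
  (Nat.cast_nonneg _).trans (le_vertexDegree T x)

lemma AtLeastBinary.vertexDegree_pos {T : List ℕ → ℕ} (hT : AtLeastBinary T) (x : List ℕ) :
    0 < vertexDegree T x := by
  linarith [hT.two_le_cast x, le_vertexDegree T x]

lemma walkDensity_nonneg (T : List ℕ → ℕ) (t : ℕ) (x : List ℕ) : 0 ≤ walkDensity T t x := by
  induction t generalizing x with
  | zero =>
    have := vertexDegree_nonneg T []
    simp only [walkDensity]
    split_ifs <;> positivity
  | succ t ih =>
    refine div_nonneg ?_ (vertexDegree_nonneg T x)
    cases x with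
    | nil => exact Finset.sum_nonneg fun i _ => ih _
    | cons j x => exact add_nonneg (Finset.sum_nonneg fun i _ => ih _) (ih _)

lemma walkDensity_eq_zero (T : List ℕ → ℕ) {t : ℕ} {x : List ℕ} (h : t < x.length) :
    walkDensity T t x = 0 := by
  induction t generalizing x with
  | zero =>
    have : x ≠ [] := by rintro rfl; simp at h
    simp [walkDensity, this]
  | succ t ih =>
    cases x with
    | nil => simp at h
    | cons j x =>
      simp only [List.length_cons] at h
      simp only [walkDensity, neighborSum]
      rw [ih (by omega), Finset.sum_eq_zero fun i _ => ih (by simp only [List.length_cons]; omega)]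
      simp

lemma walkMean_eq_sum_of_lt (T : List ℕ → ℕ) {t N : ℕ} (h : t < N) (φ : List ℕ → ℝ) :
    walkMean T t φ =
      ∑ n ∈ Finset.range N, ∑ x ∈ level T n, vertexDegree T x * walkDensity T t x * φ x := by
  refine Finset.sum_subset (Finset.range_mono h) fun n _ hn => ?_
  refine Finset.sum_eq_zero fun x hx => ?_
  rw [walkDensity_eq_zero T (by rw [(mem_level.mp hx).2]; simpa using hn)]
  ring

lemma sum_level_mul_neighborSum_zero (T : List ℕ → ℕ) (h φ : List ℕ → ℝ) :
    ∑ x ∈ level T 0, φ x * neighborSum T h x =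
      ∑ x ∈ level T 0, ∑ i ∈ Finset.range (T x), φ x * h (i :: x) := by
  simp [level, neighborSum, Finset.mul_sum]

lemma sum_level_mul_neighborSum_succ (T : List ℕ → ℕ) (n : ℕ) (h φ : List ℕ → ℝ) :
    ∑ x ∈ level T (n + 1), φ x * neighborSum T h x =
      ∑ x ∈ level T (n + 1), ∑ i ∈ Finset.range (T x), φ x * h (i :: x) +
      ∑ x ∈ level T n, ∑ i ∈ Finset.range (T x), φ (i :: x) * h x := by
  have hs := sum_level_succ T n (fun y => φ y * h y.tail)
  simp only [List.tail_cons] at hs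
  rw [← hs, ← Finset.sum_add_distrib]
  refine Finset.sum_congr rfl fun y hy => ?_
  cases y with
  | nil => simp [mem_level] at hy
  | cons j y => simp [neighborSum, mul_add, Finset.mul_sum]

/-- Summation by parts: `neighborSum` is symmetric. -/
lemma sum_mul_neighborSum_comm (T : List ℕ → ℕ) (t : ℕ) (h φ : List ℕ → ℝ)
    (hh : ∀ x, t < x.length → h x = 0) :
    ∑ n ∈ Finset.range (t + 2), ∑ x ∈ level T n, φ x * neighborSum T h x =
      ∑ n ∈ Finset.range (t + 1), ∑ x ∈ level T n, h x * neighborSum T φ x := by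
  set a : ℕ → ℝ := fun n => ∑ x ∈ level T n, ∑ i ∈ Finset.range (T x), φ x * h (i :: x) with ha
  set b : ℕ → ℝ := fun n => ∑ x ∈ level T n, ∑ i ∈ Finset.range (T x), φ (i :: x) * h x with hb
  have ha' : ∀ n, ∑ x ∈ level T n, ∑ i ∈ Finset.range (T x), h (i :: x) * φ x = a n := fun n =>
    Finset.sum_congr rfl fun x _ => Finset.sum_congr rfl fun i _ => mul_comm _ _
  have hb' : ∀ n, ∑ x ∈ level T n, ∑ i ∈ Finset.range (T x), h x * φ (i :: x) = b n := fun n =>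
    Finset.sum_congr rfl fun x _ => Finset.sum_congr rfl fun i _ => mul_comm _ _
  have hz : ∀ n, t ≤ n → a n = 0 :=
    fun n hn => Finset.sum_eq_zero fun x hx => Finset.sum_eq_zero fun i _ => by
      rw [hh _ (by simp only [List.length_cons, (mem_level.mp hx).2]; omega), mul_zero]
  have h1 : ∑ n ∈ Finset.range (t + 2), ∑ x ∈ level T n, φ x * neighborSum T h x =
      ∑ n ∈ Finset.range (t + 2), a n + ∑ n ∈ Finset.range (t + 1), b n := by
    rw [Finset.sum_range_succ', sum_level_mul_neighborSum_zero, Finset.sum_range_succ' a,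
      Finset.sum_congr rfl fun n _ => sum_level_mul_neighborSum_succ T n h φ,
      Finset.sum_add_distrib, add_right_comm]
  have h2 : ∑ n ∈ Finset.range (t + 1), ∑ x ∈ level T n, h x * neighborSum T φ x =
      ∑ n ∈ Finset.range (t + 1), b n + ∑ n ∈ Finset.range t, a n := by
    rw [Finset.sum_range_succ', sum_level_mul_neighborSum_zero, Finset.sum_range_succ' b,
      Finset.sum_congr rfl fun n _ => sum_level_mul_neighborSum_succ T n φ h,
      Finset.sum_add_distrib, add_right_comm]
    simp only [ha', hb']
  rw [h1, h2, Finset.sum_range_succ a, Finset.sum_range_succ a, hz t le_rfl, hz (t + 1) (by omega)]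
  ring

lemma walkMean_mono {T : List ℕ → ℕ} {t : ℕ} {φ ψ : List ℕ → ℝ} (h : ∀ x, φ x ≤ ψ x) :
    walkMean T t φ ≤ walkMean T t ψ :=
  Finset.sum_le_sum fun _ _ => Finset.sum_le_sum fun x _ => mul_le_mul_of_nonneg_left (h x)
    (mul_nonneg (vertexDegree_nonneg T x) (walkDensity_nonneg T t x))

lemma walkMean_add (T : List ℕ → ℕ) (t : ℕ) (φ ψ : List ℕ → ℝ) :
    walkMean T t (fun x => φ x + ψ x) = walkMean T t φ + walkMean T t ψ := by
  simp only [walkMean, mul_add, Finset.sum_add_distrib]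

lemma walkMean_const_mul (T : List ℕ → ℕ) (t : ℕ) (a : ℝ) (φ : List ℕ → ℝ) :
    walkMean T t (fun x => a * φ x) = a * walkMean T t φ := by
  simp only [walkMean, Finset.mul_sum]
  exact Finset.sum_congr rfl fun _ _ => Finset.sum_congr rfl fun x _ => by ring

namespace AtLeastBinary

variable {T : List ℕ → ℕ} (hT : AtLeastBinary T)
include hT

lemma walkMean_zero (φ : List ℕ → ℝ) : walkMean T 0 φ = φ [] := by
  have := (hT.vertexDegree_pos []).ne'
  simp [walkMean, level, walkDensity, this]

/-- One step of the walk. -/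
lemma walkMean_succ (t : ℕ) {φ d : List ℕ → ℝ}
    (h : ∀ x, neighborSum T φ x = vertexDegree T x * (φ x + d x)) :
    walkMean T (t + 1) φ = walkMean T t φ + walkMean T t d := by
  have h1 : walkMean T (t + 1) φ = ∑ n ∈ Finset.range (t + 2), ∑ x ∈ level T n,
      φ x * neighborSum T (walkDensity T t) x := by
    refine Finset.sum_congr rfl fun n _ => Finset.sum_congr rfl fun x _ => ?_
    have := (hT.vertexDegree_pos x).ne'
    rw [walkDensity]; field_simp
  rw [h1, sum_mul_neighborSum_comm T t _ _ fun x hx => walkDensity_eq_zero T hx,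
    ← walkMean_add, walkMean]
  refine Finset.sum_congr rfl fun n _ => Finset.sum_congr rfl fun x _ => ?_
  rw [h]; ring

lemma walkMean_const (t : ℕ) (c : ℝ) : walkMean T t (fun _ => c) = c := by
  induction t with
  | zero => exact hT.walkMean_zero _
  | succ t ih =>
    rw [hT.walkMean_succ t (d := fun _ => 0), ih]
    · simp [walkMean]
    · intro x
      cases x <;> simp [neighborSum, vertexDegree, add_mul]

lemma abs_walkMean_le {t : ℕ} {φ : List ℕ → ℝ} {C : ℝ} (h : ∀ x, |φ x| ≤ C) :
    |walkMean T t φ| ≤ C := by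
  rw [abs_le]
  constructor
  · rw [← hT.walkMean_const t (-C)]
    exact walkMean_mono fun x => (abs_le.mp (h x)).1
  · rw [← hT.walkMean_const t C]
    exact walkMean_mono fun x => (abs_le.mp (h x)).2

lemma rootConductance_subtree_pos (x : List ℕ) : 0 < rootConductance (subtree T x) := by
  linarith [(hT.subtree x).one_le_rootConductance]

lemma vertexDegree_le_mul_rootConductance (x : List ℕ) :
    vertexDegree T x ≤ 3 * rootConductance (subtree T x) := by
  have h := (hT.subtree x).timePerLevel_le
  rw [timePerLevel, div_le_iff₀ (hT.rootConductance_subtree_pos x), subtree_apply_nil] at h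
  exact (vertexDegree_le T x).trans h

omit hT in
lemma sum_conductance_children (x : List ℕ) :
    ∑ i ∈ Finset.range (T x), conductance (subtree T (i :: x)) = rootConductance (subtree T x) := by
  rw [rootConductance, subtree_apply_nil]
  exact Finset.sum_congr rfl fun i _ => by rw [subtree_singleton]

/-- The Green density, that is, the mean number of visits of the walk to a vertex over its degree,
is the harmonic flow through the vertex over the conductance below it. From a vertex to its child
it decreases by the probability that the walk returns from the child to the vertex. -/
lemma greenDensity_cons (i : ℕ) (x : List ℕ) :
    flowWeight harmonicFlow T (i :: x) / rootConductance (subtree T (i :: x)) =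
      flowWeight harmonicFlow T x / rootConductance (subtree T x) *
        (1 - conductance (subtree T (i :: x))) := by
  have h1 := hT.rootConductance_subtree_pos x
  have h2 := hT.rootConductance_subtree_pos (i :: x)
  rw [flowWeight, harmonicFlow, subtree_singleton, one_sub_conductance, conductance_eq]
  field_simp

lemma sum_greenDensity_children (x : List ℕ) :
    ∑ i ∈ Finset.range (T x),
      flowWeight harmonicFlow T (i :: x) / rootConductance (subtree T (i :: x)) =
      flowWeight harmonicFlow T x / rootConductance (subtree T x) *
        (T x - rootConductance (subtree T x)) := by
  rw [Finset.sum_congr rfl fun i _ => hT.greenDensity_cons i x, ← Finset.mul_sum,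
    Finset.sum_sub_distrib, sum_conductance_children]
  simp

/-- The mean number of visits to a vertex is bounded by the Green function. The Green function is
identified by the equation `g = δ + g P` that it satisfies. -/
lemma sum_walkDensity_le (t : ℕ) (x : List ℕ) :
    ∑ s ∈ Finset.range t, walkDensity T s x ≤
      flowWeight harmonicFlow T x / rootConductance (subtree T x) := by
  have hp : ∀ x, 0 ≤ flowWeight harmonicFlow T x := by
    intro x
    induction x with
    | nil => simp [flowWeight]
    | cons i x ih =>
      exact mul_nonneg ih (div_nonneg (conductance_nonneg _) (rootConductance_nonneg _))
  induction t generalizing x with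
  | zero => simpa using div_nonneg (hp x) (hT.rootConductance_subtree_pos x).le
  | succ t ih =>
    have hd := hT.vertexDegree_pos x
    have hS := hT.rootConductance_subtree_pos x
    rw [Finset.sum_range_succ']
    simp only [walkDensity]
    rw [← Finset.sum_div]
    cases x with
    | nil =>
      have h1 : ∑ s ∈ Finset.range t, neighborSum T (walkDensity T s) [] ≤
          flowWeight harmonicFlow T [] / rootConductance (subtree T []) *
            (T [] - rootConductance (subtree T [])) := by
        simp only [neighborSum]
        rw [Finset.sum_comm, ← hT.sum_greenDensity_children []]
        exact Finset.sum_le_sum fun i _ => ih _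
      rw [if_pos rfl, ← add_div, div_le_iff₀ hd]
      refine (add_le_add_left h1 1).trans (le_of_eq ?_)
      simp only [flowWeight, vertexDegree]
      field_simp
      ring
    | cons j y =>
      have h1 : ∑ s ∈ Finset.range t, neighborSum T (walkDensity T s) (j :: y) ≤
          flowWeight harmonicFlow T (j :: y) / rootConductance (subtree T (j :: y)) *
            (T (j :: y) - rootConductance (subtree T (j :: y))) +
          flowWeight harmonicFlow T y / rootConductance (subtree T y) := by
        simp only [neighborSum]
        rw [Finset.sum_add_distrib, Finset.sum_comm, ← hT.sum_greenDensity_children (j :: y)]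
        exact add_le_add (Finset.sum_le_sum fun i _ => ih _) (ih _)
      have h2 : flowWeight harmonicFlow T y / rootConductance (subtree T y) =
          flowWeight harmonicFlow T (j :: y) / rootConductance (subtree T (j :: y)) *
            (1 + rootConductance (subtree T (j :: y))) := by
        rw [hT.greenDensity_cons, one_sub_conductance]; field_simp
      rw [if_neg (by simp), add_zero, div_le_iff₀ hd]
      refine h1.trans (le_of_eq ?_)
      rw [h2, vertexDegree]; ring

/-- The total time of the walk on a level is at most three times the harmonic flow there. -/
lemma sum_walkMean_le (t : ℕ) {ψ : List ℕ → ℝ} (hψ : ∀ x, 0 ≤ ψ x) :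
    ∑ s ∈ Finset.range t, walkMean T s ψ ≤
      3 * ∑ n ∈ Finset.range t, ∑ x ∈ level T n, flowWeight harmonicFlow T x * ψ x := by
  rw [Finset.sum_congr rfl fun s hs => walkMean_eq_sum_of_lt T (Finset.mem_range.mp hs) ψ,
    Finset.sum_comm, Finset.mul_sum]
  refine Finset.sum_le_sum fun n _ => ?_
  rw [Finset.sum_comm, Finset.mul_sum]
  refine Finset.sum_le_sum fun x _ => ?_
  rw [← Finset.sum_mul, ← Finset.mul_sum, ← mul_assoc]
  refine mul_le_mul_of_nonneg_right ?_ (hψ x)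
  have hS := hT.rootConductance_subtree_pos x
  have hw : 0 ≤ flowWeight harmonicFlow T x / rootConductance (subtree T x) :=
    (by simp : (0 : ℝ) ≤ ∑ s ∈ Finset.range 0, walkDensity T s x).trans
      (hT.sum_walkDensity_le 0 x)
  calc vertexDegree T x * ∑ s ∈ Finset.range t, walkDensity T s x
      ≤ (3 * rootConductance (subtree T x)) *
        (flowWeight harmonicFlow T x / rootConductance (subtree T x)) :=
        mul_le_mul (hT.vertexDegree_le_mul_rootConductance x) (hT.sum_walkDensity_le t x)
          (Finset.sum_nonneg fun s _ => walkDensity_nonneg T s x) (by positivity)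
    _ = 3 * flowWeight harmonicFlow T x := by field_simp

/-- Nonnegative functionals summed along the ancestors of the walk are controlled by their ergodic
sums along the harmonic flow. -/
lemma walkMean_pathSum_le (t : ℕ) {η : (List ℕ → ℕ) → ℝ} (hη : ∀ T, 0 ≤ η T) :
    walkMean T t (pathSum η T) ≤
      3 * ∑ n ∈ Finset.range t, (flowAvg harmonicFlow)^[n] η T := by
  have h1 : walkMean T t (pathSum η T) ≤
      ∑ s ∈ Finset.range t, walkMean T s (fun x => η (subtree T x)) := by
    induction t with
    | zero => rw [hT.walkMean_zero]; simp [pathSum]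
    | succ t ih =>
      rw [Finset.sum_range_succ, hT.walkMean_succ t (d := fun x =>
        neighborSum T (pathSum η T) x / vertexDegree T x - pathSum η T x)]
      · refine add_le_add ih (walkMean_mono fun x => ?_)
        rw [tsub_le_iff_right, div_le_iff₀ (hT.vertexDegree_pos x)]
        have h0 := hη (subtree T x)
        cases x with
        | nil => simp [neighborSum, pathSum, vertexDegree, mul_comm]
        | cons j y =>
          have h00 := hη (subtree T y)
          simp only [neighborSum, pathSum, vertexDegree, Finset.sum_const, Finset.card_range,
            nsmul_eq_mul]
          nlinarith
      · intro x
        have := (hT.vertexDegree_pos x).ne'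
        field_simp
        ring
  refine h1.trans ((hT.sum_walkMean_le t fun x => hη _).trans (le_of_eq ?_))
  simp only [iterate_flowAvg]

end AtLeastBinary

/-- The sum of the edge function `m` along the path from the root to a vertex; the edge from a
vertex to its parent is represented by the vertex. -/
def edgeSum (m : List ℕ → ℝ) : List ℕ → ℝ
  | [] => 0
  | i :: x => edgeSum m x + m (i :: x)

/-- The part of `edgeSum m` that is expected to be undone: the sum over the edges on the path of `m`
times the probability that the walk ever goes back through the edge. -/
noncomputable def edgeReturn (T : List ℕ → ℕ) (m : List ℕ → ℝ) : List ℕ → ℝ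
  | [] => 0
  | i :: x => (1 - conductance (subtree T (i :: x))) * (edgeReturn T m x + m (i :: x))

namespace AtLeastBinary

variable {T : List ℕ → ℕ} (hT : AtLeastBinary T)
include hT

lemma abs_edgeReturn_le {m : List ℕ → ℝ} {B : ℝ} (hB : 0 ≤ B) (hm : ∀ i x, |m (i :: x)| ≤ B)
    (x : List ℕ) : |edgeReturn T m x| ≤ B := by
  induction x with
  | nil => simpa [edgeReturn] using hB
  | cons i x ih =>
    have h1 := (hT.subtree (i :: x)).half_le_conductance
    have h2 := conductance_le_one (subtree T (i :: x))
    rw [edgeReturn, abs_mul, abs_of_nonneg (by linarith)]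
    have h3 := (abs_add_le (edgeReturn T m x) (m (i :: x))).trans (add_le_add ih (hm i x))
    have h4 := abs_nonneg (edgeReturn T m x + m (i :: x))
    nlinarith

/-- The drift of `edgeSum m` with the expected returns taken off is the mean of `m` over the edges
to the children, weighted by the conductances. In particular martingales along the harmonic flow
give martingales of the walk. -/
lemma neighborSum_edgeSum_sub_edgeReturn (m : List ℕ → ℝ) (x : List ℕ) :
    neighborSum T (fun x => edgeSum m x - edgeReturn T m x) x =
      vertexDegree T x * (edgeSum m x - edgeReturn T m x +
        (∑ i ∈ Finset.range (T x), conductance (subtree T (i :: x)) * m (i :: x)) /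
          vertexDegree T x) := by
  have hd := (hT.vertexDegree_pos x).ne'
  rw [mul_add, mul_div_cancel₀ _ hd]
  have h1 : ∑ i ∈ Finset.range (T x), (edgeSum m (i :: x) - edgeReturn T m (i :: x)) =
      T x * (edgeSum m x - edgeReturn T m x) +
        rootConductance (subtree T x) * edgeReturn T m x +
        ∑ i ∈ Finset.range (T x), conductance (subtree T (i :: x)) * m (i :: x) := by
    rw [← sum_conductance_children, Finset.sum_mul, add_assoc, ← Finset.sum_add_distrib]
    have : (T x : ℝ) * (edgeSum m x - edgeReturn T m x) =
        ∑ _i ∈ Finset.range (T x), (edgeSum m x - edgeReturn T m x) := by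
      rw [Finset.sum_const, Finset.card_range, nsmul_eq_mul]
    rw [this, ← Finset.sum_add_distrib]
    refine Finset.sum_congr rfl fun i _ => ?_
    simp only [edgeSum, edgeReturn]; ring
  cases x with
  | nil =>
    simp only [neighborSum]
    rw [h1]
    simp [edgeReturn, edgeSum, vertexDegree]
  | cons j y =>
    simp only [neighborSum]
    rw [h1]
    have hS := hT.rootConductance_subtree_pos (j :: y)
    have h2 : edgeReturn T m y + m (j :: y) =
        edgeReturn T m (j :: y) * (1 + rootConductance (subtree T (j :: y))) := by
      rw [edgeReturn, one_sub_conductance]; field_simp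
    have h3 : edgeSum m y = edgeSum m (j :: y) - m (j :: y) := by simp [edgeSum]
    rw [vertexDegree, h3]
    linear_combination -h2

/-- Coboundaries of the harmonic flow summed along the ancestors of the walk stay bounded in mean:
such a sum is, up to a bounded term, a martingale along the flow, which lifts to the walk by
`neighborSum_edgeSum_sub_edgeReturn`. -/
lemma abs_walkMean_pathSum_coboundary_le (t : ℕ) {χ : (List ℕ → ℕ) → ℝ} {C : ℝ}
    (hχ : ∀ T, |χ T| ≤ C) :
    |walkMean T t (pathSum (fun T => χ T - flowAvg harmonicFlow χ T) T)| ≤ 4 * C := by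
  have hC : 0 ≤ C := (abs_nonneg _).trans (hχ T)
  have hQ : ∀ x, |flowAvg harmonicFlow χ (subtree T x)| ≤ C := by
    intro x
    have hS := hT.rootConductance_subtree_pos x
    refine (Finset.abs_sum_le_sum_abs _ _).trans ?_
    calc ∑ i ∈ Finset.range (subtree T x []), |harmonicFlow i (subtree T x) *
          χ (subtree (subtree T x) [i])|
        ≤ ∑ i ∈ Finset.range (subtree T x []), harmonicFlow i (subtree T x) * C := by
          refine Finset.sum_le_sum fun i _ => ?_
          have h0 : 0 ≤ harmonicFlow i (subtree T x) :=
            div_nonneg (conductance_nonneg _) hS.le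
          rw [abs_mul, abs_of_nonneg h0]
          exact mul_le_mul_of_nonneg_left (hχ _) h0
      _ = C := by
          rw [← Finset.sum_mul]
          simp only [harmonicFlow]
          rw [← Finset.sum_div, ← rootConductance, div_self hS.ne', one_mul]
  set m : List ℕ → ℝ := fun y => χ (subtree T y) - flowAvg harmonicFlow χ (subtree T y.tail)
    with hm
  have hmB : ∀ i x, |m (i :: x)| ≤ C + C := fun i x =>
    (abs_sub _ _).trans (add_le_add (hχ _) (hQ x))
  have hsum : ∀ x, pathSum (fun T => χ T - flowAvg harmonicFlow χ T) T x =
      (edgeSum m x - edgeReturn T m x) +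
        (χ T - χ (subtree T x) + edgeReturn T m x) := by
    intro x
    have : pathSum (fun T => χ T - flowAvg harmonicFlow χ T) T x =
        χ T - χ (subtree T x) + edgeSum m x := by
      induction x with
      | nil => simp [pathSum, edgeSum]
      | cons i x ih => rw [pathSum, ih, edgeSum]; simp only [hm, List.tail_cons]; ring
    rw [this]; ring
  have hmart : ∀ t, walkMean T t (fun x => edgeSum m x - edgeReturn T m x) = 0 := by
    intro t
    induction t with
    | zero => rw [hT.walkMean_zero]; simp [edgeSum, edgeReturn]
    | succ t ih =>
      rw [hT.walkMean_succ t (hT.neighborSum_edgeSum_sub_edgeReturn m), ih, zero_add]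
      have : ∀ x, (∑ i ∈ Finset.range (T x), conductance (subtree T (i :: x)) * m (i :: x)) /
          vertexDegree T x = 0 := by
        intro x
        have hS := (hT.rootConductance_subtree_pos x).ne'
        simp only [hm, List.tail_cons, mul_sub]
        rw [Finset.sum_sub_distrib, ← Finset.sum_mul, sum_conductance_children]
        have : rootConductance (subtree T x) * flowAvg harmonicFlow χ (subtree T x) =
            ∑ i ∈ Finset.range (T x), conductance (subtree T (i :: x)) * χ (subtree T (i :: x)) := by
          rw [flowAvg, Finset.mul_sum, subtree_apply_nil]
          refine Finset.sum_congr rfl fun i _ => ?_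
          rw [harmonicFlow, subtree_singleton]; field_simp
        rw [this, sub_self, zero_div]
      simp only [this]
      exact hT.walkMean_const t 0
  rw [show pathSum (fun T => χ T - flowAvg harmonicFlow χ T) T = _ from funext hsum,
    walkMean_add, hmart, zero_add]
  refine hT.abs_walkMean_le fun x => ?_
  have h1 := hT.abs_edgeReturn_le (by linarith) hmB x
  have h2 := abs_add_le (χ T - χ (subtree T x)) (edgeReturn T m x)
  have h3 := abs_sub (χ T) (χ (subtree T x))
  have h4 := hχ T
  have h5 := hχ (subtree T x)
  linarith

/-- The clock of the walk: `pathSum timePerLevel` grows at unit speed. -/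
lemma abs_walkMean_pathSum_timePerLevel_sub_le (t : ℕ) :
    |walkMean T t (pathSum timePerLevel T) - t| ≤ 4 := by
  set m : List ℕ → ℝ := fun y => vertexDegree T y.tail / rootConductance (subtree T y.tail)
    with hm
  have hmB : ∀ i x, |m (i :: x)| ≤ 3 := by
    intro i x
    have hS := hT.rootConductance_subtree_pos x
    simp only [hm, List.tail_cons]
    rw [abs_of_nonneg (div_nonneg (vertexDegree_nonneg T x) hS.le), div_le_iff₀ hS]
    exact hT.vertexDegree_le_mul_rootConductance x
  have hmart : walkMean T t (fun x => edgeSum m x - edgeReturn T m x) = t := by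
    induction t with
    | zero => rw [hT.walkMean_zero]; simp [edgeSum, edgeReturn]
    | succ t ih =>
      rw [hT.walkMean_succ t (hT.neighborSum_edgeSum_sub_edgeReturn m), ih]
      have : ∀ x, (∑ i ∈ Finset.range (T x), conductance (subtree T (i :: x)) * m (i :: x)) /
          vertexDegree T x = 1 := by
        intro x
        have hS := (hT.rootConductance_subtree_pos x).ne'
        have hd := (hT.vertexDegree_pos x).ne'
        simp only [hm, List.tail_cons]
        rw [← Finset.sum_mul, sum_conductance_children]
        field_simp
      simp only [this]
      rw [hT.walkMean_const]; push_cast; ring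
  have hS := hT.one_le_rootConductance
  have hdiff : ∀ x, |pathSum timePerLevel T x - edgeSum m x| ≤ 1 := by
    have : ∀ x, pathSum timePerLevel T x - edgeSum m x =
        if x = [] then 0 else 1 / rootConductance T := by
      intro x
      induction x with
      | nil => simp [pathSum, edgeSum]
      | cons i x ih =>
        have h1 : pathSum timePerLevel T (i :: x) - edgeSum m (i :: x) =
            (pathSum timePerLevel T x - edgeSum m x) + (timePerLevel (subtree T x) -
              vertexDegree T x / rootConductance (subtree T x)) := by
          simp only [pathSum, edgeSum, hm, List.tail_cons]; ring
        rw [h1, ih, if_neg (by simp : i :: x ≠ [])]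
        cases x with
        | nil =>
          simp only [if_true, timePerLevel, vertexDegree, subtree_nil]
          ring
        | cons j y =>
          simp only [timePerLevel, vertexDegree, subtree_apply_nil]
          simp
    intro x
    rw [this]
    split_ifs
    · simp
    · rw [abs_of_nonneg (by positivity), div_le_one (by linarith)]; exact hS
  have hsplit : walkMean T t (pathSum timePerLevel T) - t =
      walkMean T t (fun x => pathSum timePerLevel T x - edgeSum m x + edgeReturn T m x) := by
    have h := walkMean_add T t (fun x => edgeSum m x - edgeReturn T m x)
      (fun x => pathSum timePerLevel T x - edgeSum m x + edgeReturn T m x)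
    rw [hmart] at h
    rw [← sub_eq_iff_eq_add'.mpr h]
    congr 1
    exact congrArg _ (funext fun x => by ring)
  rw [hsplit]
  refine hT.abs_walkMean_le fun x => ?_
  have h1 := hT.abs_edgeReturn_le (by norm_num) hmB x
  have h2 := abs_add_le (pathSum timePerLevel T x - edgeSum m x) (edgeReturn T m x)
  linarith [hdiff x]

/-- The growth of `pathSum g` along the walk is compared with time by means of an approximation
of `g - h * timePerLevel` by a bounded coboundary. -/
lemma abs_walkMean_pathSum_sub_le (t : ℕ) (g χ : (List ℕ → ℕ) → ℝ) (h : ℝ) {C : ℝ}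
    (hχ : ∀ T, |χ T| ≤ C) :
    |walkMean T t (pathSum g T) - h * t| ≤ 4 * |h| + 4 * C +
      3 * ∑ n ∈ Finset.range t, (flowAvg harmonicFlow)^[n]
        (fun T => |g T - h * timePerLevel T - (χ T - flowAvg harmonicFlow χ T)|) T := by
  set η : (List ℕ → ℕ) → ℝ :=
    fun T => g T - h * timePerLevel T - (χ T - flowAvg harmonicFlow χ T) with hη
  have hsplit : ∀ x, pathSum g T x = h * pathSum timePerLevel T x +
      (pathSum (fun T => χ T - flowAvg harmonicFlow χ T) T x + pathSum η T x) := by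
    intro x
    induction x with
    | nil => simp [pathSum]
    | cons i x ih => simp only [pathSum]; rw [ih]; simp only [hη]; ring
  have habs : ∀ x, |pathSum η T x| ≤ pathSum (fun T => |η T|) T x := by
    intro x
    induction x with
    | nil => simp [pathSum]
    | cons i x ih => exact (abs_add_le _ _).trans (add_le_add ih le_rfl)
  have h1 := hT.abs_walkMean_pathSum_timePerLevel_sub_le t
  have h2 := hT.abs_walkMean_pathSum_coboundary_le t hχ
  have h3 : |walkMean T t (pathSum η T)| ≤ walkMean T t (pathSum (fun T => |η T|) T) := by
    rw [abs_le]
    constructor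
    · have := walkMean_const_mul T t (-1) (pathSum (fun T => |η T|) T)
      rw [neg_one_mul] at this
      rw [← this]
      exact walkMean_mono fun x => by linarith [(abs_le.mp (habs x)).1]
    · exact walkMean_mono fun x => (abs_le.mp (habs x)).2
  have h4 := hT.walkMean_pathSum_le t (η := fun T => |η T|) fun T => abs_nonneg _
  have h5 : walkMean T t (pathSum g T) - h * t =
      h * (walkMean T t (pathSum timePerLevel T) - t) +
      (walkMean T t (pathSum (fun T => χ T - flowAvg harmonicFlow χ T) T) +
        walkMean T t (pathSum η T)) := by
    rw [show pathSum g T = _ from funext hsplit, walkMean_add, walkMean_const_mul, walkMean_add]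
    ring
  rw [h5]
  have h6 : |h * (walkMean T t (pathSum timePerLevel T) - t)| ≤ 4 * |h| := by
    rw [abs_mul]; nlinarith [abs_nonneg h]
  have h7 := abs_add_le (h * (walkMean T t (pathSum timePerLevel T) - t))
    (walkMean T t (pathSum (fun T => χ T - flowAvg harmonicFlow χ T) T) +
        walkMean T t (pathSum η T))
  have h8 := abs_add_le (walkMean T t (pathSum (fun T => χ T - flowAvg harmonicFlow χ T) T))
    (walkMean T t (pathSum η T))
  linarith

end AtLeastBinary

/-! ### The law and the entropy of simple random walk -/

/-- The neighbours of a vertex. -/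
def neighbors (T : List ℕ → ℕ) : List ℕ → Finset (List ℕ)
  | [] => (Finset.range (T [])).image (· :: [])
  | j :: x => insert x ((Finset.range (T (j :: x))).image (· :: j :: x))

lemma mem_neighbors {T : List ℕ → ℕ} {x y : List ℕ} (hx : IsGWVertex T x) :
    y ∈ neighbors T x ↔ (gwTree T).Adj x y := by
  have hp : ∀ {z : List ℕ} {j : ℕ}, z = j :: z → False := fun h =>
    List.cons_ne_self _ _ h.symm
  cases x with
  | nil =>
    simp only [neighbors, Finset.mem_image, Finset.mem_range, gwTree]
    constructor
    · rintro ⟨i, hi, rfl⟩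
      exact ⟨hx, ⟨hx, hi⟩, Or.inl ⟨i, rfl⟩⟩
    · rintro ⟨-, hy, ⟨i, rfl⟩ | ⟨i, h⟩⟩
      · exact ⟨i, hy.2, rfl⟩
      · simp at h
  | cons j x =>
    simp only [neighbors, Finset.mem_insert, Finset.mem_image, Finset.mem_range, gwTree]
    constructor
    · rintro (rfl | ⟨i, hi, rfl⟩)
      · exact ⟨hx, hx.1, Or.inr ⟨j, rfl⟩⟩
      · exact ⟨hx, ⟨hx, hi⟩, Or.inl ⟨i, rfl⟩⟩
    · rintro ⟨-, hy, ⟨i, rfl⟩ | ⟨i, h⟩⟩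
      · exact Or.inr ⟨i, hy.2, rfl⟩
      · exact Or.inl (List.cons.inj h).2.symm

lemma sum_neighbors {M : Type*} [AddCommMonoid M] (T : List ℕ → ℕ) (h : List ℕ → M) :
    (∑ y ∈ neighbors T [], h y = ∑ i ∈ Finset.range (T []), h [i]) ∧
    ∀ j x, ∑ y ∈ neighbors T (j :: x), h y =
      h x + ∑ i ∈ Finset.range (T (j :: x)), h (i :: j :: x) := by
  constructor
  · rw [neighbors, Finset.sum_image fun i _ k _ e => (List.cons.inj e).1]
  · intro j x
    rw [neighbors, Finset.sum_insert, Finset.sum_image fun i _ k _ e => (List.cons.inj e).1]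
    intro hmem
    obtain ⟨i, -, e⟩ := Finset.mem_image.mp hmem
    have := congrArg List.length e
    simp only [List.length_cons] at this
    omega

lemma sum_neighbors_eq (T : List ℕ → ℕ) (h : List ℕ → ℝ) (x : List ℕ) :
    ∑ y ∈ neighbors T x, h y = neighborSum T h x := by
  cases x with
  | nil => exact (sum_neighbors T h).1
  | cons j x => rw [(sum_neighbors T h).2, neighborSum, add_comm]

lemma card_neighbors (T : List ℕ → ℕ) (x : List ℕ) :
    ((neighbors T x).card : ℝ) = vertexDegree T x := by
  have h := sum_neighbors_eq T (fun _ => 1) x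
  simp only [Finset.sum_const, nsmul_eq_mul, mul_one] at h
  rw [h]
  cases x <;> simp [neighborSum, vertexDegree]

lemma uniformOr_coe {V : Type*} [DecidableEq V] {s : Finset V} (hs : s.Nonempty) (x y : V) :
    uniformOr (s : Set V) x y = if y ∈ s then ((s.card : ENNReal))⁻¹ else 0 := by
  have h : (s : Set V).Finite ∧ (s : Set V).Nonempty := ⟨s.finite_toSet, hs⟩
  rw [uniformOr, dif_pos h, PMF.uniformOfFinset_apply]
  simp

namespace AtLeastBinary

variable {T : List ℕ → ℕ} (hT : AtLeastBinary T)
include hT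

lemma srwStep_apply {x : List ℕ} (hx : IsGWVertex T x) (y : List ℕ) :
    srwStep (gwTree T) x y =
      if y ∈ neighbors T x then ENNReal.ofReal (vertexDegree T x)⁻¹ else 0 := by
  have hs : (gwTree T).neighborSet x = (neighbors T x : Set (List ℕ)) := by
    ext y
    rw [SimpleGraph.mem_neighborSet, Finset.mem_coe, mem_neighbors hx]
  have hne : (neighbors T x).Nonempty := by
    rw [← Finset.card_pos]
    have h := hT.vertexDegree_pos x
    rw [← card_neighbors] at h
    exact_mod_cast h
  rw [srwStep, hs, uniformOr_coe hne, ENNReal.ofReal_inv_of_pos (hT.vertexDegree_pos x),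
    ← card_neighbors, ENNReal.ofReal_natCast]

open Classical in
lemma srwLaw_apply (t : ℕ) (y : List ℕ) :
    srwLaw (gwTree T) [] t y = if IsGWVertex T y then
      ENNReal.ofReal (vertexDegree T y * walkDensity T t y) else 0 := by
  induction t generalizing y with
  | zero =>
    have := (hT.vertexDegree_pos []).ne'
    rw [srwLaw, PMF.pure_apply]
    by_cases hy : y = []
    · subst hy; simp [IsGWVertex, walkDensity, this]
    · simp [hy, walkDensity]
  | succ t ih =>
    rw [srwLaw, PMF.bind_apply]
    have hterm : ∀ x, srwLaw (gwTree T) [] t x * srwStep (gwTree T) x y =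
        if IsGWVertex T y ∧ x ∈ neighbors T y then ENNReal.ofReal (walkDensity T t x) else 0 := by
      intro x
      rw [ih]
      by_cases hx : IsGWVertex T x
      · have hiff : (IsGWVertex T y ∧ x ∈ neighbors T y) ↔ y ∈ neighbors T x := by
          rw [mem_neighbors hx]
          constructor
          · rintro ⟨hy, h⟩; exact ((mem_neighbors hy).mp h).symm
          · intro h; exact ⟨h.2.1, (mem_neighbors h.2.1).mpr h.symm⟩
        rw [if_pos hx, hT.srwStep_apply hx]
        simp only [hiff]
        split_ifs
        · rw [← ENNReal.ofReal_mul (mul_nonneg (vertexDegree_nonneg T x)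
            (walkDensity_nonneg T t x))]
          have := (hT.vertexDegree_pos x).ne'
          congr 1; field_simp
        · rw [mul_zero]
      · rw [if_neg hx, zero_mul, if_neg]
        rintro ⟨hy, h⟩
        exact hx ((mem_neighbors hy).mp h).2.1
    rw [tsum_congr hterm]
    by_cases hy : IsGWVertex T y
    · simp only [hy, true_and, if_true]
      rw [tsum_eq_sum (s := neighbors T y) fun x hx => if_neg hx,
        Finset.sum_congr rfl fun x hx => if_pos hx,
        ← ENNReal.ofReal_sum_of_nonneg fun x _ => walkDensity_nonneg T t x, sum_neighbors_eq,
        walkDensity]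
      have := (hT.vertexDegree_pos y).ne'
      congr 1; field_simp
    · simp [hy]

omit hT in
/-- The entropy of a law with finite support on the vertices, level by level. -/
lemma shannonEntropy_eq_sum_level (μ : PMF (List ℕ)) (N : ℕ)
    (h0 : ∀ x, (IsGWVertex T x → N ≤ x.length) → (μ x).toReal = 0) :
    shannonEntropy μ = ∑ n ∈ Finset.range N, ∑ x ∈ level T n,
      -((μ x).toReal * Real.log (μ x).toReal) := by
  rw [shannonEntropy, tsum_eq_sum (s := (Finset.range N).biUnion (level T)),
    Finset.sum_biUnion, ← Finset.sum_neg_distrib]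
  · exact Finset.sum_congr rfl fun n _ => Finset.sum_neg_distrib _ |>.symm
  · intro n _ k _ hnk
    refine Finset.disjoint_left.mpr fun x hx hx' => hnk ?_
    rw [← (mem_level.mp hx).2, (mem_level.mp hx').2]
  · intro x hx
    rw [h0, zero_mul]
    intro hv
    by_contra hlt
    exact hx (Finset.mem_biUnion.mpr ⟨x.length, Finset.mem_range.mpr (not_le.mp hlt),
      mem_level.mpr ⟨hv, rfl⟩⟩)

lemma shannonEntropy_srwLaw (t : ℕ) : shannonEntropy (srwLaw (gwTree T) [] t) =
    walkMean T t fun x => -Real.log (vertexDegree T x * walkDensity T t x) := by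
  classical
  rw [shannonEntropy_eq_sum_level (T := T) _ (t + 1), walkMean]
  · refine Finset.sum_congr rfl fun n _ => Finset.sum_congr rfl fun x hx => ?_
    rw [hT.srwLaw_apply, if_pos (mem_level.mp hx).1, ENNReal.toReal_ofReal
      (mul_nonneg (vertexDegree_nonneg T x) (walkDensity_nonneg T t x))]
    ring
  · intro x hx
    rw [hT.srwLaw_apply]
    split_ifs with hv
    · rw [walkDensity_eq_zero T (hx hv)]; simp
    · simp

lemma flowWeight_harmonicFlow_pos (x : List ℕ) :
    IsGWVertex T x → 0 < flowWeight harmonicFlow T x := by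
  induction x with
  | nil => intro _; simp [flowWeight]
  | cons i x ih =>
    intro h
    refine mul_pos (ih h.1) (div_pos ?_ (hT.rootConductance_subtree_pos x))
    rw [subtree_singleton]
    linarith [(hT.subtree (i :: x)).half_le_conductance]

lemma sum_level_flowWeight_harmonicFlow (n : ℕ) :
    ∑ x ∈ level T n, flowWeight harmonicFlow T x = 1 := by
  induction n with
  | zero => simp [level, flowWeight]
  | succ n ih =>
    rw [sum_level_succ, ← ih]
    refine Finset.sum_congr rfl fun x _ => ?_
    simp only [flowWeight, harmonicFlow, subtree_singleton]
    rw [← Finset.mul_sum, ← Finset.sum_div, sum_conductance_children,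
      div_self (hT.rootConductance_subtree_pos x).ne', mul_one]

/-- The Green function decays along a path by the factors `1 + rootConductance`. -/
lemma abs_log_green_add_pathSum_le (x : List ℕ) (hx : IsGWVertex T x) :
    |Real.log (vertexDegree T x *
        (flowWeight harmonicFlow T x / rootConductance (subtree T x))) +
      pathSum (fun T => Real.log (1 + rootConductance T)) T x| ≤ 2 := by
  have key : ∀ x, IsGWVertex T x →
      Real.log (flowWeight harmonicFlow T x / rootConductance (subtree T x)) =
        Real.log (1 + rootConductance T) - Real.log (rootConductance T) -
        Real.log (1 + rootConductance (subtree T x)) -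
        pathSum (fun T => Real.log (1 + rootConductance T)) T x := by
    intro x
    induction x with
    | nil => intro _; simp [flowWeight, pathSum]
    | cons i x ih =>
      intro h
      have h1 := hT.rootConductance_subtree_pos (i :: x)
      have h2 := div_pos (hT.flowWeight_harmonicFlow_pos x h.1) (hT.rootConductance_subtree_pos x)
      rw [hT.greenDensity_cons, one_sub_conductance, Real.log_mul h2.ne' (by positivity), ih h.1,
        one_div, Real.log_inv, pathSum]
      ring
  have hd := hT.vertexDegree_pos x
  have hg := div_pos (hT.flowWeight_harmonicFlow_pos x hx) (hT.rootConductance_subtree_pos x)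
  rw [Real.log_mul hd.ne' hg.ne', key x hx]
  have hS := hT.one_le_rootConductance
  have hSx := (hT.subtree x).half_le_rootConductance
  have hSx' := rootConductance_le (subtree T x)
  have hDx := hT.two_le_cast x
  have hd1 := vertexDegree_le T x
  have hd2 := le_vertexDegree T x
  rw [subtree_apply_nil] at hSx hSx'
  have hlog2 : Real.log 2 < 1 := by linarith [Real.log_two_lt_d9]
  have e1 : Real.log (1 + rootConductance T) ≤ Real.log 2 + Real.log (rootConductance T) := by
    rw [← Real.log_mul two_ne_zero (by linarith)]
    exact Real.log_le_log (by linarith) (by linarith)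
  have e2 : Real.log (rootConductance T) ≤ Real.log (1 + rootConductance T) :=
    Real.log_le_log (by linarith) (by linarith)
  have e3 : Real.log (vertexDegree T x) ≤
      Real.log 2 + Real.log (1 + rootConductance (subtree T x)) := by
    rw [← Real.log_mul two_ne_zero (by linarith)]
    exact Real.log_le_log hd (by linarith)
  have e4 : Real.log (1 + rootConductance (subtree T x)) ≤
      Real.log 2 + Real.log (vertexDegree T x) := by
    rw [← Real.log_mul two_ne_zero (by linarith)]
    exact Real.log_le_log (by linarith) (by linarith)
  rw [abs_le]
  constructor <;> linarith

/-- The entropy of the walk is the mean of the logarithm of the Green function, up to a logarithmic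
error: the law is dominated by the Green function, whose mass in a ball grows linearly. -/
lemma abs_shannonEntropy_srwLaw_sub_le (t : ℕ) :
    |shannonEntropy (srwLaw (gwTree T) [] t) -
      walkMean T t (pathSum (fun T => Real.log (1 + rootConductance T)) T)| ≤
      2 + Real.log (3 * (t + 1)) := by
  set w := pathSum (fun T => Real.log (1 + rootConductance T)) T with hw
  set G : List ℕ → ℝ := fun x => vertexDegree T x *
    (flowWeight harmonicFlow T x / rootConductance (subtree T x)) with hG
  set P : List ℕ → ℝ := fun x => vertexDegree T x * walkDensity T t x with hP
  have hPG : ∀ x, P x ≤ G x := by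
    intro x
    refine mul_le_mul_of_nonneg_left ((Finset.single_le_sum (f := fun s => walkDensity T s x)
      (fun s _ => walkDensity_nonneg T s x) (Finset.self_mem_range_succ t)).trans
      (hT.sum_walkDensity_le (t + 1) x)) (vertexDegree_nonneg T x)
  have hP0 : ∀ x, 0 ≤ P x := fun x =>
    mul_nonneg (vertexDegree_nonneg T x) (walkDensity_nonneg T t x)
  have hGpos : ∀ x, IsGWVertex T x → 0 < G x := fun x hx =>
    mul_pos (hT.vertexDegree_pos x)
      (div_pos (hT.flowWeight_harmonicFlow_pos x hx) (hT.rootConductance_subtree_pos x))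
  have hGsum : ∑ n ∈ Finset.range (t + 1), ∑ x ∈ level T n, G x ≤ 3 * (t + 1) := by
    calc ∑ n ∈ Finset.range (t + 1), ∑ x ∈ level T n, G x
        ≤ ∑ n ∈ Finset.range (t + 1), ∑ x ∈ level T n, 3 * flowWeight harmonicFlow T x := by
          refine Finset.sum_le_sum fun n _ => Finset.sum_le_sum fun x hx => ?_
          have hS := hT.rootConductance_subtree_pos x
          have hf := hT.flowWeight_harmonicFlow_pos x (mem_level.mp hx).1
          calc G x ≤ 3 * rootConductance (subtree T x) *
                (flowWeight harmonicFlow T x / rootConductance (subtree T x)) :=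
                mul_le_mul_of_nonneg_right (hT.vertexDegree_le_mul_rootConductance x)
                  (by positivity)
            _ = 3 * flowWeight harmonicFlow T x := by field_simp
      _ = 3 * (t + 1) := by
          simp only [← Finset.mul_sum, hT.sum_level_flowWeight_harmonicFlow]
          simp
  have hPsum : ∑ n ∈ Finset.range (t + 1), ∑ x ∈ level T n, P x = 1 := by
    have := hT.walkMean_const t 1
    simpa [walkMean, hP] using this
  have hL : 0 < (3 * ((t : ℝ) + 1)) := by positivity
  rw [hT.shannonEntropy_srwLaw, abs_le]
  have hterm : ∀ x, IsGWVertex T x →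
      P x * (w x) - 2 * P x ≤ P x * (-Real.log (P x)) ∧
      P x * (-Real.log (P x)) ≤
        P x * w x + (2 + Real.log (3 * (t + 1))) * P x + (G x / (3 * (t + 1)) - P x) := by
    intro x hx
    have hg := hGpos x hx
    have hb := abs_le.mp (hT.abs_log_green_add_pathSum_le x hx)
    rcases (hP0 x).eq_or_lt with h | h
    · rw [← h]; simp; positivity
    · have h1 : Real.log (P x) ≤ Real.log (G x) := Real.log_le_log h (hPG x)
      constructor
      · nlinarith [hb.2]
      · have h2 := Real.log_le_sub_one_of_pos (x := G x / (3 * (t + 1)) / P x) (by positivity)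
        rw [Real.log_div (by positivity) h.ne', Real.log_div hg.ne' hL.ne'] at h2
        have h3 : P x * (Real.log (G x) - Real.log (3 * (t + 1)) - Real.log (P x)) ≤
            G x / (3 * (t + 1)) - P x := by
          calc _ ≤ P x * (G x / (3 * (t + 1)) / P x - 1) := mul_le_mul_of_nonneg_left h2 h.le
            _ = _ := by field_simp
        nlinarith [hb.1]
  constructor
  · have h1 : walkMean T t w - 2 ≤ walkMean T t fun x => -Real.log (P x) := by
      calc walkMean T t w - 2 = ∑ n ∈ Finset.range (t + 1), ∑ x ∈ level T n,
            (P x * w x - 2 * P x) := by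
            simp only [Finset.sum_sub_distrib, ← Finset.mul_sum, hPsum, mul_one]; rfl
        _ ≤ _ := Finset.sum_le_sum fun n _ => Finset.sum_le_sum fun x hx =>
            (hterm x (mem_level.mp hx).1).1
    have h2 : 0 ≤ Real.log (3 * (t + 1)) := Real.log_nonneg (by
      have : (0 : ℝ) ≤ t := Nat.cast_nonneg t
      linarith)
    linarith
  · have h1 : walkMean T t (fun x => -Real.log (P x)) ≤
        walkMean T t w + (2 + Real.log (3 * (t + 1))) +
          ((∑ n ∈ Finset.range (t + 1), ∑ x ∈ level T n, G x) / (3 * (t + 1)) - 1) := by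
      calc walkMean T t (fun x => -Real.log (P x)) ≤
          ∑ n ∈ Finset.range (t + 1), ∑ x ∈ level T n,
            (P x * w x + (2 + Real.log (3 * (t + 1))) * P x + (G x / (3 * (t + 1)) - P x)) :=
            Finset.sum_le_sum fun n _ => Finset.sum_le_sum fun x hx =>
              (hterm x (mem_level.mp hx).1).2
        _ = _ := by
            simp only [Finset.sum_add_distrib, Finset.sum_sub_distrib, ← Finset.mul_sum,
              ← Finset.sum_div, hPsum, mul_one]
            rfl
    have h2 : (∑ n ∈ Finset.range (t + 1), ∑ x ∈ level T n, G x) / (3 * (t + 1)) ≤ 1 :=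
      (div_le_one hL).mpr hGsum
    linarith

end AtLeastBinary

/-! ### The law and the entropy of the nonbacktracking walk -/

namespace AtLeastBinary

variable {T : List ℕ → ℕ} (hT : AtLeastBinary T)
include hT

lemma flowWeight_uniformFlow_pos (x : List ℕ) : 0 < flowWeight uniformFlow T x := by
  induction x with
  | nil => simp [flowWeight]
  | cons i x ih =>
    have := hT.two_le_cast x
    rw [flowWeight, uniformFlow, subtree_apply_nil]; positivity

omit hT in
/-- Away from its parent, a vertex has its children as neighbours. At the root, which is recorded as
its own predecessor, nothing is removed. -/
lemma neighborSet_diff_tail {x : List ℕ} (hx : IsGWVertex T x) :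
    (gwTree T).neighborSet x \ {x.tail} = ((Finset.range (T x)).image (· :: x) : Finset _) := by
  ext y
  rw [Set.mem_sdiff, SimpleGraph.mem_neighborSet, ← mem_neighbors hx, Finset.mem_coe,
    Set.mem_singleton_iff]
  cases x with
  | nil =>
    simp only [neighbors, List.tail_nil, and_iff_left_iff_imp, Finset.mem_image]
    rintro ⟨i, -, rfl⟩
    simp
  | cons j x =>
    simp only [neighbors, Finset.mem_insert, List.tail_cons, Finset.mem_image]
    constructor
    · rintro ⟨h | h, hne⟩
      · exact absurd h hne
      · exact h
    · rintro ⟨i, hi, rfl⟩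
      refine ⟨Or.inr ⟨i, hi, rfl⟩, fun h => ?_⟩
      have := congrArg List.length h
      simp only [List.length_cons] at this
      omega

lemma nbrwStep_apply {x : List ℕ} (hx : IsGWVertex T x) (q : List ℕ × List ℕ) :
    nbrwStep (gwTree T) (x.tail, x) q =
      if q.1 = x ∧ q.2 ∈ (Finset.range (T x)).image (· :: x) then
        ENNReal.ofReal (uniformFlow 0 (subtree T x)) else 0 := by
  have hpos : 0 < T x := by linarith [hT x]
  have hne : ((Finset.range (T x)).image (· :: x)).Nonempty :=
    (Finset.nonempty_range_iff.mpr hpos.ne').image _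
  have hcard : ((Finset.range (T x)).image (· :: x)).card = T x := by
    rw [Finset.card_image_of_injective _ fun i k e => (List.cons.inj e).1, Finset.card_range]
  have hinv : ((T x : ENNReal))⁻¹ = ENNReal.ofReal (uniformFlow 0 (subtree T x)) := by
    rw [uniformFlow, subtree_apply_nil, one_div, ENNReal.ofReal_inv_of_pos (by exact_mod_cast hpos),
      ENNReal.ofReal_natCast]
  obtain ⟨a, b⟩ := q
  rw [nbrwStep, neighborSet_diff_tail hx, PMF.map_apply]
  refine (tsum_eq_single b fun z hz => if_neg fun e => hz (Prod.mk.inj e).2.symm).trans ?_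
  rw [uniformOr_coe hne, hcard, hinv]
  by_cases ha : a = x
  · simp [ha]
  · simp [ha]

lemma nbrwPairLaw_apply (t : ℕ) (q : List ℕ × List ℕ) :
    nbrwPairLaw (gwTree T) [] t q = if q.1 = q.2.tail ∧ q.2 ∈ level T t then
      ENNReal.ofReal (flowWeight uniformFlow T q.2) else 0 := by
  induction t generalizing q with
  | zero =>
    obtain ⟨a, b⟩ := q
    rw [nbrwPairLaw, PMF.pure_apply]
    by_cases hb : b = []
    · subst hb; simp [level, flowWeight]
    · simp [level, hb]
  | succ t ih =>
    obtain ⟨a, b⟩ := q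
    rw [nbrwPairLaw, PMF.bind_apply, tsum_eq_single (a.tail, a)]
    · rw [ih]
      by_cases ha : a ∈ level T t
      · rw [if_pos ⟨rfl, ha⟩, hT.nbrwStep_apply (mem_level.mp ha).1]
        have hiff : (a = a ∧ b ∈ (Finset.range (T a)).image (· :: a)) ↔
            (a = b.tail ∧ b ∈ level T (t + 1)) := by
          simp only [true_and, Finset.mem_image, Finset.mem_range, level, Finset.mem_biUnion]
          constructor
          · rintro ⟨i, hi, rfl⟩
            exact ⟨rfl, a, ha, i, hi, rfl⟩
          · rintro ⟨h, a', ha', i, hi, rfl⟩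
            rw [List.tail_cons] at h
            subst h
            exact ⟨i, hi, rfl⟩
        rw [if_congr hiff rfl rfl]
        split_ifs with h
        · obtain ⟨i, -, rfl⟩ := Finset.mem_image.mp (hiff.mpr h).2
          rw [← ENNReal.ofReal_mul (hT.flowWeight_uniformFlow_pos a |>.le)]
          rfl
        · rw [mul_zero]
      · rw [if_neg fun h => ha h.2, zero_mul, if_neg]
        rintro ⟨h, hb⟩
        simp only [level, Finset.mem_biUnion, Finset.mem_image] at hb
        obtain ⟨a', ha', i, -, rfl⟩ := hb
        have h' : a = a' := h
        subst h'
        exact ha ha'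
    · rintro ⟨c, d⟩ hne
      rw [ih]
      split_ifs with h
      · obtain ⟨h1, h2⟩ := h
        simp only at h1 h2
        subst h1
        rw [hT.nbrwStep_apply (mem_level.mp h2).1, if_neg, mul_zero]
        rintro ⟨h3, -⟩
        simp only at h3
        subst h3
        exact hne rfl
      · rw [zero_mul]

lemma nbrwLaw_apply (t : ℕ) (x : List ℕ) :
    nbrwLaw (gwTree T) [] t x =
      if x ∈ level T t then ENNReal.ofReal (flowWeight uniformFlow T x) else 0 := by
  rw [nbrwLaw, PMF.map_apply, tsum_eq_single (x.tail, x)]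
  · rw [if_pos rfl, hT.nbrwPairLaw_apply]; simp
  · rintro ⟨c, d⟩ hne
    rw [hT.nbrwPairLaw_apply]
    split_ifs with h1 h2
    · simp only at h1 h2
      exact absurd (by rw [h1, h2.1]) hne
    · rfl
    · rfl

/-- The entropy of the nonbacktracking walk is an ergodic sum of the uniform flow: a vertex on level
`t` determines the path to it, and a step from a vertex adds the logarithm of its number of
children. -/
lemma shannonEntropy_nbrwLaw (t : ℕ) : shannonEntropy (nbrwLaw (gwTree T) [] t) =
    ∑ k ∈ Finset.range t,
      (flowAvg uniformFlow)^[k] (fun T : List ℕ → ℕ => Real.log (T [])) T := by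
  have h1 : ∀ t, shannonEntropy (nbrwLaw (gwTree T) [] t) =
      ∑ x ∈ level T t, -(flowWeight uniformFlow T x * Real.log (flowWeight uniformFlow T x)) := by
    intro t
    rw [shannonEntropy, tsum_eq_sum (s := level T t), ← Finset.sum_neg_distrib]
    · refine Finset.sum_congr rfl fun x hx => ?_
      rw [hT.nbrwLaw_apply, if_pos hx, ENNReal.toReal_ofReal (hT.flowWeight_uniformFlow_pos x).le]
    · intro x hx
      rw [hT.nbrwLaw_apply, if_neg hx]; simp
  rw [h1]
  induction t with
  | zero => simp [level, flowWeight]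
  | succ t ih =>
    rw [Finset.sum_range_succ, ← ih, sum_level_succ, iterate_flowAvg, ← Finset.sum_add_distrib]
    refine Finset.sum_congr rfl fun x _ => ?_
    have hD := hT.two_le_cast x
    have hw := hT.flowWeight_uniformFlow_pos x
    simp only [flowWeight, uniformFlow, subtree_apply_nil]
    rw [Finset.sum_const, Finset.card_range, nsmul_eq_mul, Real.log_mul hw.ne' (by positivity),
      one_div, Real.log_inv]
    field_simp
    ring

end AtLeastBinary

/-! ### Existence and comparison of the entropies -/

lemma tendsto_one_div_mul_of_abs_sub_le {a : ℕ → ℝ} {h : ℝ}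
    (H : ∀ ε > 0, ∃ C, ∀ t : ℕ, |a t - h * t| ≤ C + ε * t) :
    Tendsto (fun t : ℕ => (1 / (t : ℝ)) * a t) atTop (𝓝 h) := by
  rw [Metric.tendsto_atTop]
  intro ε hε
  obtain ⟨C, hC⟩ := H (ε / 2) (by positivity)
  obtain ⟨N, hN⟩ := exists_nat_gt (2 * |C| / ε)
  refine ⟨N + 1, fun t ht => ?_⟩
  have ht0 : (0 : ℝ) < t := by exact_mod_cast Nat.lt_of_lt_of_le (Nat.succ_pos N) ht
  have htN : (N : ℝ) < t := by exact_mod_cast ht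
  have h1 : 2 * |C| < ε * t := by
    have := hN.trans htN
    rw [div_lt_iff₀ hε] at this
    linarith
  have h2 : 1 / (t : ℝ) * a t - h = (a t - h * t) / t := by field_simp
  rw [Real.dist_eq, h2, abs_div, abs_of_pos ht0, div_lt_iff₀ ht0]
  have := hC t
  have := le_abs_self C
  linarith

section Limits

variable (ν : Measure ℕ) [IsProbabilityMeasure ν]

lemma isNBRWEntropy_integral_log (hν : ∀ᵐ n ∂ν, 2 ≤ n)
    (hint : Integrable (fun n : ℕ => (n : ℝ)) ν) :
    IsNBRWEntropy ν (∫ T, Real.log (T []) ∂(gwMeasure ν)) := by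
  set h := ∫ T : List ℕ → ℕ, Real.log (T []) ∂(gwMeasure ν) with hh
  have hp := isStationaryFlow_uniformFlow ν hν
  have hL := memLp_log_children ν hν hint
  have hm : Measurable fun T : List ℕ → ℕ => Real.log (T []) - h := by fun_prop
  have hg2 : MemLp (fun T : List ℕ → ℕ => Real.log (T []) - h) 2 (gwMeasure ν) :=
    hL.sub (memLp_const h)
  have hg0 : ∫ T : List ℕ → ℕ, (Real.log (T []) - h) ∂(gwMeasure ν) = 0 := by
    rw [integral_sub (hL.integrable one_le_two) (integrable_const h), integral_const]
    simp [hh]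
  unfold IsNBRWEntropy
  filter_upwards [hp.ae_exists_coboundary hν hm hg2 hg0, ae_atLeastBinary ν hν] with T hco hT
  refine tendsto_one_div_mul_of_abs_sub_le fun ε hε => ?_
  obtain ⟨χ, ⟨C, hC⟩, hχ⟩ := hco ε hε
  refine ⟨2 * C, fun t => ?_⟩
  set η : (List ℕ → ℕ) → ℝ := fun T => Real.log (T []) - h - (χ T - flowAvg uniformFlow χ T)
    with hη
  have hstep : ∀ k, (flowAvg uniformFlow)^[k] (fun T : List ℕ → ℕ => Real.log (T [])) T - h =
      (flowAvg uniformFlow)^[k] χ T - (flowAvg uniformFlow)^[k + 1] χ T +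
        (flowAvg uniformFlow)^[k] η T := by
    intro k
    have h1 : h = ∑ x ∈ level T k, flowWeight uniformFlow T x * h := by
      rw [← Finset.sum_mul, hp.sum_flowWeight hT, one_mul]
    rw [Function.iterate_succ_apply]
    simp only [iterate_flowAvg]
    conv_lhs => rw [h1]
    rw [← Finset.sum_sub_distrib, ← Finset.sum_sub_distrib, ← Finset.sum_add_distrib]
    refine Finset.sum_congr rfl fun x _ => ?_
    simp only [hη]
    ring
  have habs : ∀ k (f : (List ℕ → ℕ) → ℝ), |(flowAvg uniformFlow)^[k] f T| ≤
      (flowAvg uniformFlow)^[k] (fun T => |f T|) T := by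
    intro k f
    simp only [iterate_flowAvg]
    refine (Finset.abs_sum_le_sum_abs _ _).trans (le_of_eq ?_)
    refine Finset.sum_congr rfl fun x _ => ?_
    rw [abs_mul, abs_of_nonneg (hp.flowWeight_nonneg T x)]
  have hbd : |(flowAvg uniformFlow)^[t] χ T| ≤ C := by
    refine (habs t χ).trans ?_
    rw [iterate_flowAvg]
    calc ∑ x ∈ level T t, flowWeight uniformFlow T x * |χ (subtree T x)|
        ≤ ∑ x ∈ level T t, flowWeight uniformFlow T x * C :=
          Finset.sum_le_sum fun x _ =>
            mul_le_mul_of_nonneg_left (hC _) (hp.flowWeight_nonneg T x)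
      _ = C := by rw [← Finset.sum_mul, hp.sum_flowWeight hT, one_mul]
  have hsum : shannonEntropy (nbrwLaw (gwTree T) [] t) - h * t =
      χ T - (flowAvg uniformFlow)^[t] χ T +
        ∑ k ∈ Finset.range t, (flowAvg uniformFlow)^[k] η T := by
    have h1 : h * t = ∑ _k ∈ Finset.range t, h := by
      rw [Finset.sum_const, Finset.card_range, nsmul_eq_mul, mul_comm]
    rw [hT.shannonEntropy_nbrwLaw, h1, ← Finset.sum_sub_distrib,
      Finset.sum_congr rfl fun k _ => hstep k, Finset.sum_add_distrib,
      Finset.sum_range_sub' (fun k => (flowAvg uniformFlow)^[k] χ T)]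
    rfl
  rw [hsum]
  have h2 : |∑ k ∈ Finset.range t, (flowAvg uniformFlow)^[k] η T| ≤ t * ε :=
    (Finset.abs_sum_le_sum_abs _ _).trans
      ((Finset.sum_le_sum fun k _ => habs k η).trans (hχ t))
  have h3 := abs_add_le (χ T - (flowAvg uniformFlow)^[t] χ T)
    (∑ k ∈ Finset.range t, (flowAvg uniformFlow)^[k] η T)
  have h4 := abs_sub (χ T) ((flowAvg uniformFlow)^[t] χ T)
  have h5 := hC T
  linarith

lemma isSRWEntropy_walkEntropyRate (hν : ∀ᵐ n ∂ν, 2 ≤ n)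
    (hint : Integrable (fun n : ℕ => (n : ℝ)) ν) :
    IsSRWEntropy ν (walkEntropyRate ν) := by
  set h := walkEntropyRate ν with hh
  have hp := isStationaryFlow_harmonicFlow ν hν
  have hw2 := memLp_log_one_add_rootConductance ν hint
  have hb2 := memLp_timePerLevel ν hν
  have hm : Measurable fun T => Real.log (1 + rootConductance T) - h * timePerLevel T :=
    (measurable_rootConductance.const_add 1).log.sub (measurable_timePerLevel.const_mul h)
  have hg2 : MemLp (fun T => Real.log (1 + rootConductance T) - h * timePerLevel T) 2
      (harmonicMeasure ν) := hw2.sub (hb2.const_mul h)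
  have hg0 : ∫ T, (Real.log (1 + rootConductance T) - h * timePerLevel T)
      ∂(harmonicMeasure ν) = 0 := by
    rw [integral_sub (hw2.integrable one_le_two) ((hb2.integrable one_le_two).const_mul h),
      integral_const_mul, integral_timePerLevel ν hν, ← walkEntropyRate]
    simp [hh]
  unfold IsSRWEntropy
  filter_upwards [hp.ae_exists_coboundary hν hm hg2 hg0, ae_atLeastBinary ν hν] with T hco hT
  refine tendsto_one_div_mul_of_abs_sub_le fun ε hε => ?_
  obtain ⟨χ, ⟨C, hC⟩, hχ⟩ := hco (ε / 6) (by positivity)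
  refine ⟨4 * |h| + 4 * C + 2 + (ε / 2 - Real.log (ε / 6)), fun t => ?_⟩
  have h1 := hT.abs_walkMean_pathSum_sub_le t (fun T => Real.log (1 + rootConductance T)) χ h hC
  have h2 := hT.abs_shannonEntropy_srwLaw_sub_le t
  have h3 := hχ t
  have h4 : Real.log (3 * (t + 1)) ≤ ε / 2 * (t + 1) - Real.log (ε / 6) := by
    have := Real.log_le_sub_one_of_pos (x := ε / 6 * (3 * (t + 1))) (by positivity)
    rw [Real.log_mul (by positivity) (by positivity)] at this
    linarith
  have h5 := abs_sub_le (shannonEntropy (srwLaw (gwTree T) [] t))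
    (walkMean T t (pathSum (fun T => Real.log (1 + rootConductance T)) T)) (h * t)
  linarith

end Limits

theorem proposition1p2 {Ω : Type*} [MeasurableSpace Ω] (P : Measure Ω) [IsProbabilityMeasure P]
    (Z : Ω → ℕ) (hZ_meas : Measurable Z) (hZ_int : Integrable (fun ω => (Z ω : ℝ)) P)
    (hZ_ge : ∀ᵐ ω ∂P, 2 ≤ Z ω) :
    ∃ hX hY : ℝ, IsSRWEntropy (P.map Z) hX ∧ IsNBRWEntropy (P.map Z) hY ∧
      hX < hY ∧ hY = ∫ ω, Real.log (Z ω) ∂P := by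
  have : IsProbabilityMeasure (P.map Z) :=
    Measure.isProbabilityMeasure_map hZ_meas.aemeasurable
  have hν : ∀ᵐ n ∂(P.map Z), 2 ≤ n :=
    (ae_map_iff hZ_meas.aemeasurable (measurableSet_le measurable_const measurable_id)).mpr hZ_ge
  have hint : Integrable (fun n : ℕ => (n : ℝ)) (P.map Z) :=
    (integrable_map_measure Measurable.of_discrete.aestronglyMeasurable
      hZ_meas.aemeasurable).mpr hZ_int
  have hlog : ∫ n, Real.log n ∂(P.map Z) = ∫ ω, Real.log (Z ω) ∂P :=
    integral_map hZ_meas.aemeasurable Measurable.of_discrete.aestronglyMeasurable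
  refine ⟨walkEntropyRate (P.map Z), ∫ T, Real.log (T []) ∂(gwMeasure (P.map Z)),
    isSRWEntropy_walkEntropyRate _ hν hint, isNBRWEntropy_integral_log _ hν hint, ?_, ?_⟩
  · exact walkEntropyRate_lt _ hν hint
  · rw [integral_log_children, hlog]
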